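/- Let $(M,g)$ be a smooth finite-dimensional Riemannian manifold without boundary, $\nabla$ its Levi-Civita connection, $\tau:TM\to M$ its tangent bundle, $TTM=HTM\oplus VTM$ the splitting into horizontal and vertical vectors determined by $\nabla$, and $X^H,X^V\in T_u(TM)$ the horizontal and vertical lifts of $X\in T_{\tau(u)}M$. Put $t=\frac12 g(u,u)$ for $u\in TM$. On $TM$ consider the Sasaki metric and almost complex structure $$g_S(X^H,Y^H)=g_S(X^V,Y^V)=g(X,Y),\quad g_S(X^H,Y^V)=0,\quad J_SX^H=X^V,\quad J_SX^V=-X^H.$$ Given smooth functions $a,b:[0,\infty)\to\mathbb R$ with $a(t)>0$ and $a(t)+2tb(t)>0$ for all $t\ge 0$, and $\epsilon\in\{1,-1\}$, consider also the metric $$g_A(X^H,Y^H)=g(X,Y),\quad g_A(X^H,Y^V)=0,\quad g_A(X^V,Y^V)=a(t)\,g(X,Y)+b(t)\,g(X,u)\,g(Y,u)$$ and, at all $u\neq0$, the almost complex structure $$J_AX^H=\tfrac1{\sqrt a}X^V-\tfrac1{2t}\Big(\tfrac1{\sqrt a}+\tfrac{\epsilon}{\sqrt{a+2bt}}\Big)g(X,u)\,u^V,\qquad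 J_AX^V=-\sqrt a\,X^H+\tfrac1{2t}\big(\sqrt a+\epsilon\sqrt{a+2bt}\big)g(X,u)\,u^H .$$ For $r>0$ let $T_rM=\{u\in TM: g(u,u)=r^2\}$. If $S\subset TM$ is a hypersurface with unit normal field $N$ for an ambient metric $G$ and $J$ is an ambient almost complex structure, the induced structure on $S$ is $\varphi U=\tan(JU)$, $\xi=-JN$, $\eta(U)N=\mathrm{nor}(JU)$ for $U$ tangent to $S$, together with the restriction of $G$; here $\tan$ and $\mathrm{nor}$ are the $G$-orthogonal projections to $TS$ and to the normal bundle. An almost contact metric structure $(\varphi,\xi,\eta,G)$ consists of a smooth field of endomorphisms, a smooth vector field, a smooth 1-form and a Riemannian metric such that $$\varphi^2=-I+\eta\otimes\xi,\quad \varphi\xi=0,\quad \eta\circ\varphi=0,\quad \eta(\xi)=1,\quad G(\varphi U,\varphi V)=G(U,V)-\eta(U)\eta(V).$$ It is a contact metric structure if moreover $d\eta(U,V)=G(U,\varphi V)$, where $d\eta(U,V)=\frac12\big(U\eta(V)-V\eta(U)-\eta([U,V])\big)$. Then: 1. For every $r>0$, $T_rM$ is a smooth embedded hypersurface of $TM$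 with $g_S$-unit normal $N_r=\frac1r u^V$, and the structure $(\varphi_r,\xi_r,\eta_r,G_r)$ induced from $(g_S,J_S)$ is an almost contact metric structure on $T_rM$. The rescaled structure $$\Big(\varphi_r,\ 2r\,\xi_r,\ \tfrac1{2r}\,\eta_r,\ \tfrac1{4r^2}\,G_r\Big)$$ is a contact metric structure on $T_rM$. 2. $T_1M$ is a smooth embedded hypersurface of $TM$ with $g_A$-unit normal $N=\frac1{\sqrt{a(1/2)+b(1/2)}}\,u^V$, and the structure $(\varphi_A,\xi_A,\eta_A,G_A)$ induced from $(g_A,J_A)$ is an almost contact metric structure on $T_1M$. With $a_0=a(1/2)$, the rescaled structure $$\Big(\varphi_A,\ -2\epsilon\sqrt{a_0}\,\xi_A,\ -\tfrac{\epsilon}{2\sqrt{a_0}}\,\eta_A,\ \tfrac1{4a_0}\,G_A\Big)$$ is a contact metric structure on $T_1M$. -/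

import Mathlib

open Set
open scoped Manifold ContDiff Topology

noncomputable section

/-! ### Hypersurfaces of a manifold and tensor fields on them

`N` is a manifold and `S` a subset of `N` (below always an embedded hypersurface). Objects living on
`S` are written as ambient maps, of which only the values at the points of `S`, on vectors tangent
to `S`, are used. -/

section Hypersurface

variable {F : Type*} [NormedAddCommGroup F] [NormedSpace ℝ F] {H : Type*} [TopologicalSpace H]
  (J : ModelWithCorners ℝ F H) {N : Type*} [TopologicalSpace N] [ChartedSpace H N]
  [IsManifold J ∞ N]

/-- `S` is a smooth embedded hypersurface: near each of its points it is the zero set of a smooth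
function whose differential does not vanish there. -/
def IsHypersurface (S : Set N) : Prop :=
  ∀ x ∈ S, ∃ (U : Set N) (f : N → ℝ), IsOpen U ∧ x ∈ U ∧ ContMDiffOn J 𝓘(ℝ, ℝ) ∞ f U ∧
    S ∩ U = {y ∈ U | f y = 0} ∧ mvfderiv J f x ≠ 0

/-- The tangent space of `S` at `x`: the vectors annihilated by the differentials of all smooth
functions near `x` that vanish on `S`. For an embedded submanifold this is the usual tangent
space, as a subspace of the ambient one. -/
def tangentAt (S : Set N) (x : N) : Submodule ℝ (TangentSpace J x) where
  carrier := {w | ∀ (U : Set N) (f : N → ℝ), IsOpen U → x ∈ U → ContMDiffOn J 𝓘(ℝ, ℝ) ∞ f U →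
    (∀ y ∈ S ∩ U, f y = 0) → mvfderiv J f x w = 0}
  add_mem' hv hw U f hU hx hf h0 := by
    rw [map_add, hv U f hU hx hf h0, hw U f hU hx hf h0, add_zero]
  zero_mem' _ _ _ _ _ _ := map_zero _
  smul_mem' c w hw U f hU hx hf h0 := by rw [map_smul, hw U f hU hx hf h0, smul_zero]

/-- The vector field `X` is smooth on the open set `U`. -/
def SmoothField (U : Set N) (X : ∀ x : N, TangentSpace J x) : Prop :=
  ContMDiffOn J J.tangent ∞ (fun x ↦ (⟨x, X x⟩ : TangentBundle J N)) U

/-- A smooth vector field on the open piece `S ∩ U` of `S`, presented by a smooth vector field on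
the open set `U` which is tangent to `S` along `S`. -/
structure IsLocalField (S U : Set N) (X : ∀ x : N, TangentSpace J x) : Prop where
  isOpen : IsOpen U
  smooth : SmoothField J U X
  tangent : ∀ x ∈ S ∩ U, X x ∈ tangentAt J S x

/-- The function `p` is smooth on `S ∩ U`: locally it is the restriction of a smooth function on
an open set of the ambient manifold. -/
def SmoothFunAlong (S U : Set N) (p : N → ℝ) : Prop :=
  ∀ x ∈ S ∩ U, ∃ (V : Set N) (q : N → ℝ), IsOpen V ∧ x ∈ V ∧ ContMDiffOn J 𝓘(ℝ, ℝ) ∞ q V ∧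
    ∀ y ∈ S ∩ V, p y = q y

/-- The vector field `X` is smooth on `S ∩ U`: locally it is the restriction of a smooth vector
field on an open set of the ambient manifold. -/
def SmoothFieldAlong (S U : Set N) (X : ∀ x : N, TangentSpace J x) : Prop :=
  ∀ x ∈ S ∩ U, ∃ (V : Set N) (Y : ∀ x : N, TangentSpace J x), IsOpen V ∧ x ∈ V ∧
    SmoothField J V Y ∧ ∀ y ∈ S ∩ V, X y = Y y

/-- `n` is a smooth unit normal vector field of `S` for the ambient metric `G`. -/
structure IsUnitNormal (S : Set N)
    (G : ∀ x : N, TangentSpace J x →ₗ[ℝ] TangentSpace J x →ₗ[ℝ] ℝ)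
    (n : ∀ x : N, TangentSpace J x) : Prop where
  smooth : SmoothFieldAlong J S univ n
  unit : ∀ x ∈ S, G x (n x) (n x) = 1
  normal : ∀ x ∈ S, ∀ w ∈ tangentAt J S x, G x (n x) w = 0

/-- `(φ, ξ, η, G)` is an almost contact metric structure on `S`: `φ` is a smooth field of
endomorphisms of the tangent spaces, `ξ` a smooth tangent vector field, `η` a smooth 1-form, `G` a
Riemannian metric, and `φ² = -id + η ⊗ ξ`, `φ ξ = 0`, `η ∘ φ = 0`, `η ξ = 1`,
`G (φ v) (φ w) = G v w - η v * η w`. -/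
structure IsAlmostContactMetric (S : Set N)
    (φ : ∀ x : N, TangentSpace J x →ₗ[ℝ] TangentSpace J x)
    (ξ : ∀ x : N, TangentSpace J x)
    (η : ∀ x : N, TangentSpace J x →ₗ[ℝ] ℝ)
    (G : ∀ x : N, TangentSpace J x →ₗ[ℝ] TangentSpace J x →ₗ[ℝ] ℝ) : Prop where
  φ_tangent : ∀ x ∈ S, ∀ v ∈ tangentAt J S x, φ x v ∈ tangentAt J S x
  ξ_tangent : ∀ x ∈ S, ξ x ∈ tangentAt J S x
  φ_smooth : ∀ U X, IsLocalField J S U X → SmoothFieldAlong J S U (fun x ↦ φ x (X x))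
  ξ_smooth : SmoothFieldAlong J S univ ξ
  η_smooth : ∀ U X, IsLocalField J S U X → SmoothFunAlong J S U (fun x ↦ η x (X x))
  G_smooth : ∀ U X Y, IsLocalField J S U X → IsLocalField J S U Y →
    SmoothFunAlong J S U (fun x ↦ G x (X x) (Y x))
  G_symm : ∀ x ∈ S, ∀ v ∈ tangentAt J S x, ∀ w ∈ tangentAt J S x, G x v w = G x w v
  G_pos : ∀ x ∈ S, ∀ v ∈ tangentAt J S x, v ≠ 0 → 0 < G x v v
  φ_φ : ∀ x ∈ S, ∀ v ∈ tangentAt J S x, φ x (φ x v) = -v + η x v • ξ x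
  φ_ξ : ∀ x ∈ S, φ x (ξ x) = 0
  η_φ : ∀ x ∈ S, ∀ v ∈ tangentAt J S x, η x (φ x v) = 0
  η_ξ : ∀ x ∈ S, η x (ξ x) = 1
  compatible : ∀ x ∈ S, ∀ v ∈ tangentAt J S x, ∀ w ∈ tangentAt J S x,
    G x (φ x v) (φ x w) = G x v w - η x v * η x w

/-- `Ω` is the exterior derivative of the 1-form `η` on `S`, with the convention
`dη (X, Y) = (X (η Y) - Y (η X) - η [X, Y]) / 2` for vector fields `X, Y` on open pieces of `S`.
Here `p` and `q` are ambient smooth functions that restrict to `η X` and `η Y`; as `X` and `Y`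
are tangent to `S`, their derivatives below depend only on these restrictions. -/
def IsExteriorDerivative (S : Set N) (η : ∀ x : N, TangentSpace J x →ₗ[ℝ] ℝ)
    (Ω : ∀ x : N, TangentSpace J x → TangentSpace J x → ℝ) : Prop :=
  ∀ (U : Set N) (X Y : ∀ x : N, TangentSpace J x) (p q : N → ℝ),
    IsLocalField J S U X → IsLocalField J S U Y →
    ContMDiffOn J 𝓘(ℝ, ℝ) ∞ p U → ContMDiffOn J 𝓘(ℝ, ℝ) ∞ q U →
    (∀ x ∈ S ∩ U, p x = η x (X x)) → (∀ x ∈ S ∩ U, q x = η x (Y x)) →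
    ∀ x ∈ S ∩ U, VectorField.mlieBracket J X Y x ∈ tangentAt J S x ∧
      Ω x (X x) (Y x) = (1 / 2 : ℝ) * (mvfderiv J q x (X x) -
        mvfderiv J p x (Y x) - η x (VectorField.mlieBracket J X Y x))

/-- `(φ, ξ, η, G)` is a contact metric structure on `S`: an almost contact metric structure with
`dη (v, w) = G v (φ w)`. -/
structure IsContactMetric (S : Set N)
    (φ : ∀ x : N, TangentSpace J x →ₗ[ℝ] TangentSpace J x)
    (ξ : ∀ x : N, TangentSpace J x)
    (η : ∀ x : N, TangentSpace J x →ₗ[ℝ] ℝ)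
    (G : ∀ x : N, TangentSpace J x →ₗ[ℝ] TangentSpace J x →ₗ[ℝ] ℝ) : Prop
    extends IsAlmostContactMetric J S φ ξ η G where
  contact : IsExteriorDerivative J S η (fun x v w ↦ G x v (φ x w))

/-! The structure induced on a hypersurface with unit normal `n` by an ambient metric `G` and an
ambient almost complex structure `I`. The tangential part of a vector `w` is `w - G (w, n) n`, its
normal part is `G (w, n) n`. -/

/-- `φ v` is the tangential part of `I v`. -/
def inducedPhi (G : ∀ x : N, TangentSpace J x →ₗ[ℝ] TangentSpace J x →ₗ[ℝ] ℝ)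
    (I : ∀ x : N, TangentSpace J x →ₗ[ℝ] TangentSpace J x) (n : ∀ x : N, TangentSpace J x) (x : N) :
    TangentSpace J x →ₗ[ℝ] TangentSpace J x :=
  (LinearMap.id - ((G x).flip (n x)).smulRight (n x)) ∘ₗ I x

/-- `ξ = -I n`. -/
def inducedXi (I : ∀ x : N, TangentSpace J x →ₗ[ℝ] TangentSpace J x)
    (n : ∀ x : N, TangentSpace J x) (x : N) : TangentSpace J x :=
  -I x (n x)

/-- `η v` is the coefficient of `n` in the normal part of `I v`. -/
def inducedEta (G : ∀ x : N, TangentSpace J x →ₗ[ℝ] TangentSpace J x →ₗ[ℝ] ℝ)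
    (I : ∀ x : N, TangentSpace J x →ₗ[ℝ] TangentSpace J x) (n : ∀ x : N, TangentSpace J x) (x : N) :
    TangentSpace J x →ₗ[ℝ] ℝ :=
  (G x).flip (n x) ∘ₗ I x

end Hypersurface

/-! ### The geometry of the tangent bundle of a Riemannian manifold -/

section TangentBundle

variable {E : Type*} [NormedAddCommGroup E] [NormedSpace ℝ E]
  {M : Type*} [TopologicalSpace M] [ChartedSpace E M] [IsManifold 𝓘(ℝ, E) ∞ M]
  (g : Bundle.ContMDiffRiemannianMetric 𝓘(ℝ, E) ∞ E (fun x : M ↦ TangentSpace 𝓘(ℝ, E) x))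

/-- The components of the metric in the preferred chart at `p`, as a function of the point `z` of
the chart: `chartMetric g p z v w` is `g_ij(z) v^i w^j`. -/
def chartMetric (p : M) (z : E) : E →L[ℝ] E →L[ℝ] ℝ :=
  let x : M := (extChartAt 𝓘(ℝ, E) p).symm z
  let e : E →L[ℝ] E := (trivializationAt E (TangentSpace 𝓘(ℝ, E)) p).symmL ℝ x
  let G : E →L[ℝ] E →L[ℝ] ℝ := g.inner x
  G.bilinearComp e e

/-- The scalar product `g_p` as a bilinear form. -/
def gForm (p : M) : TangentSpace 𝓘(ℝ, E) p →ₗ[ℝ] TangentSpace 𝓘(ℝ, E) p →ₗ[ℝ] ℝ :=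
  LinearMap.mk₂ ℝ (fun v w ↦ g.inner p v w) (by simp) (by simp) (by simp) (by simp)

/-- The scalar product `g_p`, in the coordinates of the preferred chart at `p`. -/
def gFormE (p : M) : LinearMap.BilinForm ℝ E :=
  gForm g p

lemma gFormE_nondegenerate (p : M) : (gFormE g p).Nondegenerate := by
  constructor <;> intro v hv <;> by_contra h
  · exact (g.pos p v h).ne' (hv v)
  · exact (g.pos p v h).ne' (hv v)

lemma chartMetric_symm (p : M) (z v w : E) : chartMetric g p z v w = chartMetric g p z w v := by
  set x : M := (extChartAt 𝓘(ℝ, E) p).symm z with hx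
  set e : E →L[ℝ] E := (trivializationAt E (TangentSpace 𝓘(ℝ, E)) p).symmL ℝ x with he
  exact g.symm x (e v) (e w)

lemma fderiv_symm_of_symm (f : E → E →L[ℝ] E →L[ℝ] ℝ) (hf : ∀ z v w, f z v w = f z w v)
    (z u v w : E) : fderiv ℝ f z u v w = fderiv ℝ f z u w v := by
  by_cases h : DifferentiableAt ℝ f z
  · have key : ∀ v w : E, fderiv ℝ (fun y ↦ f y v w) z u = fderiv ℝ f z u v w := by
      intro v w
      have h1 : DifferentiableAt ℝ (fun y ↦ f y v) z := h.clm_apply (differentiableAt_const v)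
      rw [fderiv_clm_apply h1 (differentiableAt_const w),
        fderiv_clm_apply h (differentiableAt_const v)]
      simp
    rw [← key v w, ← key w v]
    simp only [hf _ v w]
  · rw [fderiv_zero_of_not_differentiableAt h]
    simp

/-- The derivative at `p` of the components of the metric in the preferred chart at `p`:
`dMetric g p u v w` is `u^k ∂_k g_ij v^i w^j`. -/
def dMetric (p : M) : E →L[ℝ] E →L[ℝ] E →L[ℝ] ℝ :=
  fderiv ℝ (chartMetric g p) (extChartAt 𝓘(ℝ, E) p p)

/-- The Christoffel symbols of the first kind `(∂_i g_jk + ∂_j g_ik - ∂_k g_ij) v^i u^j w^k / 2`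
in the preferred chart at `p`, evaluated at `p`, as a linear function of `w`. -/
def christoffelFirst (p : M) (v u : E) : Module.Dual ℝ E where
  toFun w := (1 / 2 : ℝ) * (dMetric g p v u w + dMetric g p u v w - dMetric g p w v u)
  map_add' w w' := by simp; ring
  map_smul' c w := by simp; ring

lemma dMetric_symm (p : M) (u v w : E) : dMetric g p u v w = dMetric g p u w v :=
  fderiv_symm_of_symm _ (chartMetric_symm g p) _ u v w

variable [FiniteDimensional ℝ E]

/-- `christoffel g p v u` is `Γ_ij^k v^i u^j`, with the Christoffel symbols of the Levi-Civita
connection in the preferred chart at `p`, evaluated at `p`. -/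
def christoffel (p : M) : E →ₗ[ℝ] E →ₗ[ℝ] E :=
  LinearMap.mk₂ ℝ
    (fun v u ↦ ((gFormE g p).toDual (gFormE_nondegenerate g p)).symm (christoffelFirst g p v u))
    (fun v v' u ↦ by rw [← map_add]; congr 1; ext w; simp [christoffelFirst]; ring)
    (fun c v u ↦ by rw [← map_smul]; congr 1; ext w; simp [christoffelFirst]; ring)
    (fun v u u' ↦ by rw [← map_add]; congr 1; ext w; simp [christoffelFirst]; ring)
    (fun c v u ↦ by rw [← map_smul]; congr 1; ext w; simp [christoffelFirst]; ring)

/-- The connection is torsion-free: `Γ_ij^k = Γ_ji^k`. -/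
lemma christoffel_symm (p : M) (v u : E) : christoffel g p v u = christoffel g p u v := by
  change ((gFormE g p).toDual (gFormE_nondegenerate g p)).symm (christoffelFirst g p v u) =
    ((gFormE g p).toDual (gFormE_nondegenerate g p)).symm (christoffelFirst g p u v)
  congr 1
  ext w
  simp only [christoffelFirst, LinearMap.coe_mk, AddHom.coe_mk]
  rw [dMetric_symm g p w v u]
  ring

lemma gFormE_christoffel (p : M) (v u w : E) :
    gFormE g p (christoffel g p v u) w =
      (1 / 2 : ℝ) * (dMetric g p v u w + dMetric g p u v w - dMetric g p w v u) :=
  LinearMap.BilinForm.apply_toDual_symm_apply (hB := gFormE_nondegenerate g p)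
    (christoffelFirst g p v u) w

/-- The connection is metric: `∂_k g_ij = Γ_ki^l g_lj + Γ_kj^l g_il`. -/
lemma dMetric_eq (p : M) (u v w : E) :
    dMetric g p u v w =
      gFormE g p (christoffel g p u v) w + gFormE g p (christoffel g p u w) v := by
  rw [gFormE_christoffel, gFormE_christoffel, dMetric_symm g p u w v]
  ring

/-! A vector tangent to `TM` at a point `u` over `p` is, by the chart `(x^i, y^i)` of `TM` induced
by the preferred chart `(x^i)` at `p`, a pair `(v, w)`, meaning `v^i ∂/∂x^i + w^i ∂/∂y^i`. -/

/-- The vertical lift `w^i ∂/∂y^i` of a tangent vector `w` of `M` to the point `u` of `TM`. -/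
def vLift (u : TangentBundle 𝓘(ℝ, E) M) :
    TangentSpace 𝓘(ℝ, E) u.proj →ₗ[ℝ] TangentSpace 𝓘(ℝ, E).tangent u :=
  (LinearMap.inr ℝ E E : E →ₗ[ℝ] E × E)

/-- The horizontal lift `v^i (∂/∂x^i - Γ_ij^k u^j ∂/∂y^k)` of a tangent vector `v` of `M` to the
point `u` of `TM`. -/
def hLift (u : TangentBundle 𝓘(ℝ, E) M) :
    TangentSpace 𝓘(ℝ, E) u.proj →ₗ[ℝ] TangentSpace 𝓘(ℝ, E).tangent u :=
  (LinearMap.prod LinearMap.id (-(christoffel g u.proj).flip u.snd) : E →ₗ[ℝ] E × E)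

/-- The horizontal component of a tangent vector of `TM`: its image under the differential of the
projection `TM → M`. -/
def hComp (u : TangentBundle 𝓘(ℝ, E) M) :
    TangentSpace 𝓘(ℝ, E).tangent u →ₗ[ℝ] TangentSpace 𝓘(ℝ, E) u.proj :=
  (LinearMap.fst ℝ E E : E × E →ₗ[ℝ] E)

/-- The vertical component of a tangent vector of `TM` (the connection map). -/
def vComp (u : TangentBundle 𝓘(ℝ, E) M) :
    TangentSpace 𝓘(ℝ, E).tangent u →ₗ[ℝ] TangentSpace 𝓘(ℝ, E) u.proj :=
  (LinearMap.snd ℝ E E + (christoffel g u.proj).flip u.snd ∘ₗ LinearMap.fst ℝ E E :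
    E × E →ₗ[ℝ] E)

/-- The splitting of a tangent vector of `TM` into its horizontal and vertical parts. -/
lemma hLift_add_vLift (u : TangentBundle 𝓘(ℝ, E) M) (w : TangentSpace 𝓘(ℝ, E).tangent u) :
    hLift g u (hComp u w) + vLift u (vComp g u w) = w := by
  obtain ⟨v, w⟩ := w
  refine Prod.ext (add_zero (v : E)) ?_
  change (-christoffel g u.proj v u.snd : E) + ((w : E) + christoffel g u.proj v u.snd) = w
  abel

/-- The 1-form `w ↦ g (K w, u)` on `TM`, where `K w` is the vertical component of `w`. -/
def vRadial (u : TangentBundle 𝓘(ℝ, E) M) : TangentSpace 𝓘(ℝ, E).tangent u →ₗ[ℝ] ℝ :=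
  (gForm g u.proj).flip u.snd ∘ₗ vComp g u

/-- The 1-form `w ↦ g (τ_* w, u)` on `TM`, where `τ_* w` is the horizontal component of `w`. -/
def hRadial (u : TangentBundle 𝓘(ℝ, E) M) : TangentSpace 𝓘(ℝ, E).tangent u →ₗ[ℝ] ℝ :=
  (gForm g u.proj).flip u.snd ∘ₗ hComp u

/-- The energy density `t = g (u, u) / 2`. -/
def energy (u : TangentBundle 𝓘(ℝ, E) M) : ℝ :=
  (1 / 2 : ℝ) * g.inner u.proj u.snd u.snd

/-- The Sasaki metric: `g_S (X^H, Y^H) = g_S (X^V, Y^V) = g (X, Y)`, `g_S (X^H, Y^V) = 0`. -/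
def sasakiMetric (u : TangentBundle 𝓘(ℝ, E) M) :
    TangentSpace 𝓘(ℝ, E).tangent u →ₗ[ℝ] TangentSpace 𝓘(ℝ, E).tangent u →ₗ[ℝ] ℝ :=
  (gForm g u.proj).compl₁₂ (hComp u) (hComp u) + (gForm g u.proj).compl₁₂ (vComp g u) (vComp g u)

/-- The almost complex structure `J_S X^H = X^V`, `J_S X^V = -X^H`. -/
def sasakiJ (u : TangentBundle 𝓘(ℝ, E) M) :
    TangentSpace 𝓘(ℝ, E).tangent u →ₗ[ℝ] TangentSpace 𝓘(ℝ, E).tangent u :=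
  vLift u ∘ₗ hComp u - hLift g u ∘ₗ vComp g u

/-- The metric `g_A`: `g_A (X^H, Y^H) = g (X, Y)`, `g_A (X^H, Y^V) = 0`,
`g_A (X^V, Y^V) = a(t) g (X, Y) + b(t) g (X, u) g (Y, u)`. -/
def generalMetric (a b : ℝ → ℝ) (u : TangentBundle 𝓘(ℝ, E) M) :
    TangentSpace 𝓘(ℝ, E).tangent u →ₗ[ℝ] TangentSpace 𝓘(ℝ, E).tangent u →ₗ[ℝ] ℝ :=
  (gForm g u.proj).compl₁₂ (hComp u) (hComp u) +
    a (energy g u) • (gForm g u.proj).compl₁₂ (vComp g u) (vComp g u) +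
    b (energy g u) • (vRadial g u).smulRight (vRadial g u)

/-- The almost complex structure `J_A` with sign `ε`:
`J_A X^H = X^V / √a - (1 / √a + ε / √(a + 2bt)) / (2t) g (X, u) u^V`,
`J_A X^V = -√a X^H + (√a + ε √(a + 2bt)) / (2t) g (X, u) u^H`. -/
def generalJ (a b : ℝ → ℝ) (ε : ℝ) (u : TangentBundle 𝓘(ℝ, E) M) :
    TangentSpace 𝓘(ℝ, E).tangent u →ₗ[ℝ] TangentSpace 𝓘(ℝ, E).tangent u :=
  let t := energy g u
  (1 / √(a t)) • (vLift u ∘ₗ hComp u) -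
    (1 / (2 * t) * (1 / √(a t) + ε * (1 / √(a t + 2 * b t * t)))) •
      (hRadial g u).smulRight (vLift u u.snd) -
    √(a t) • (hLift g u ∘ₗ vComp g u) +
    (1 / (2 * t) * (√(a t) + ε * √(a t + 2 * b t * t))) •
      (vRadial g u).smulRight (hLift g u u.snd)

/-- The tangent sphere bundle `T_r M` of radius `r`. -/
def sphereBundle (r : ℝ) : Set (TangentBundle 𝓘(ℝ, E) M) :=
  {u | g.inner u.proj u.snd u.snd = r ^ 2}

/-- The unit normal `N_r = u^V / r` of `T_r M` for the Sasaki metric. -/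
def sasakiNormal (r : ℝ) (u : TangentBundle 𝓘(ℝ, E) M) : TangentSpace 𝓘(ℝ, E).tangent u :=
  (1 / r) • vLift u u.snd

/-- The unit normal `u^V / √(a(1/2) + b(1/2))` of `T_1 M` for the metric `g_A`. -/
def generalNormal (a b : ℝ → ℝ) (u : TangentBundle 𝓘(ℝ, E) M) :
    TangentSpace 𝓘(ℝ, E).tangent u :=
  (1 / √(a (1 / 2) + b (1 / 2))) • vLift u u.snd

/-- `φ_r v` is the tangential part of `J_S v`. -/
def phiR (r : ℝ) (u : TangentBundle 𝓘(ℝ, E) M) :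
    TangentSpace 𝓘(ℝ, E).tangent u →ₗ[ℝ] TangentSpace 𝓘(ℝ, E).tangent u :=
  inducedPhi 𝓘(ℝ, E).tangent (sasakiMetric g) (sasakiJ g) (sasakiNormal r) u

/-- `ξ_r = -J_S N_r`. -/
def xiR (r : ℝ) (u : TangentBundle 𝓘(ℝ, E) M) : TangentSpace 𝓘(ℝ, E).tangent u :=
  inducedXi 𝓘(ℝ, E).tangent (sasakiJ g) (sasakiNormal r) u

/-- `η_r v` is the coefficient of `N_r` in the normal part of `J_S v`. -/
def etaR (r : ℝ) (u : TangentBundle 𝓘(ℝ, E) M) : TangentSpace 𝓘(ℝ, E).tangent u →ₗ[ℝ] ℝ :=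
  inducedEta 𝓘(ℝ, E).tangent (sasakiMetric g) (sasakiJ g) (sasakiNormal r) u

/-- `φ_A v` is the tangential part of `J_A v`. -/
def phiA (a b : ℝ → ℝ) (ε : ℝ) (u : TangentBundle 𝓘(ℝ, E) M) :
    TangentSpace 𝓘(ℝ, E).tangent u →ₗ[ℝ] TangentSpace 𝓘(ℝ, E).tangent u :=
  inducedPhi 𝓘(ℝ, E).tangent (generalMetric g a b) (generalJ g a b ε) (generalNormal a b) u

/-- `ξ_A = -J_A N`, with `N` the unit normal of `T_1 M`. -/
def xiA (a b : ℝ → ℝ) (ε : ℝ) (u : TangentBundle 𝓘(ℝ, E) M) : TangentSpace 𝓘(ℝ, E).tangent u :=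
  inducedXi 𝓘(ℝ, E).tangent (generalJ g a b ε) (generalNormal a b) u

/-- `η_A v` is the coefficient of the unit normal of `T_1 M` in the normal part of `J_A v`. -/
def etaA (a b : ℝ → ℝ) (ε : ℝ) (u : TangentBundle 𝓘(ℝ, E) M) :
    TangentSpace 𝓘(ℝ, E).tangent u →ₗ[ℝ] ℝ :=
  inducedEta 𝓘(ℝ, E).tangent (generalMetric g a b) (generalJ g a b ε) (generalNormal a b) u

end TangentBundle
end

/-! The Sasaki pair is the case `a = 1`, `b = 0`, `ε = -1` of `g_A`, `J_A`, so both claims follow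
from one computation on `T_r M`. Write `τ_* w` and `K w` for the horizontal and vertical components
of `w`. Since the connection is metric, `w ↦ g (K w, u)` is the differential of the energy density
`t`. So `w` is tangent to `T_r M` exactly when `K w` is orthogonal to `u`, and `u^V` is normal. On
tangent vectors the `b` term of `g_A` vanishes and `t` is the constant `r² / 2`. Put `s = √a(r² /
2)` and `θ w = g (τ_* w, u)`. Rescaling the induced structure by a constant `c ≠ 0` gives
(`isStandardForm_induced`) `φ w = (-s K w)^H + (s⁻¹ (τ_* w - θ(w) u / r²))^V`, `ξ = κ u^H`, `η = θ /
(κ r²)`, `G = (g (τ_*, τ_*) + s² g (K, K)) / (κ r)²`, where `κ = -c ε / r`. The almost contact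
identities are then linear algebra in the two components.

The contact condition rests on `2 dθ (X, Y) = g (K X, τ_* Y) - g (K Y, τ_* X)`
(`hRadial_mlieBracket`), which holds because the connection is metric and torsion-free. Calling the
right side `B`, one has `dη = B / (2 κ r²)` and `G (X, φ Y) = s B / (κ r)²`. These agree when `κ = 2
s`, that is `c = -2 ε r s`: this is `2 r` in the Sasaki case and `-2 ε √a(1/2)` on `T_1 M`.

The remaining work is smoothness. Horizontal lifts and `K` are defined at each point through the
preferred chart of that very point. In a fixed chart they are controlled by the transformation law
of the Christoffel symbols, whose second derivative term cancels the one in the coordinate changes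
of `TTM` (`tangentCoord₂_eq`). -/

set_option maxSynthPendingDepth 3

noncomputable section

/-! ### The Christoffel symbols of a metric on a vector space -/

section ChartCalculus

variable {E : Type*} [NormedAddCommGroup E] [NormedSpace ℝ E]

/-- The Christoffel symbols of the first kind of a field of bilinear forms. -/
def lowerChristoffel (G : E → E →L[ℝ] E →L[ℝ] ℝ) (z v u : E) : E →L[ℝ] ℝ :=
  (1 / 2 : ℝ) • (fderiv ℝ G z v u + fderiv ℝ G z u v - ((fderiv ℝ G z).flip v).flip u)

lemma lowerChristoffel_apply (G : E → E →L[ℝ] E →L[ℝ] ℝ) (z v u w : E) :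
    lowerChristoffel G z v u w = (1 / 2 : ℝ) *
      (fderiv ℝ G z v u w + fderiv ℝ G z u v w - fderiv ℝ G z w v u) := by
  simp [lowerChristoffel]

/-- The Christoffel symbols of the second kind of a field of nondegenerate bilinear forms. -/
def chartChristoffel (G : E → E →L[ℝ] E →L[ℝ] ℝ) (z v u : E) : E :=
  (G z).inverse (lowerChristoffel G z v u)

lemma ContinuousLinearMap.isInvertible_of_pos [FiniteDimensional ℝ E] {B : E →L[ℝ] E →L[ℝ] ℝ}
    (hB : ∀ v, v ≠ 0 → 0 < B v v) : B.IsInvertible := by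
  have hinj : Function.Injective B := by
    rw [injective_iff_map_eq_zero]
    intro v hv
    by_contra h
    exact (hB v h).ne' (by simp [hv])
  have hrank : Module.finrank ℝ E = Module.finrank ℝ (E →L[ℝ] ℝ) := by
    rw [← LinearEquiv.finrank_eq (LinearMap.toContinuousLinearMap (𝕜 := ℝ) (E := E) (F' := ℝ))]
    exact (Subspace.dual_finrank_eq).symm
  let e : E ≃ₗ[ℝ] (E →L[ℝ] ℝ) :=
    LinearEquiv.ofInjectiveOfFinrankEq (B : E →ₗ[ℝ] (E →L[ℝ] ℝ)) hinj hrank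
  refine ⟨e.toContinuousLinearEquiv, ?_⟩
  ext v w
  rfl

lemma chartChristoffel_spec {G : E → E →L[ℝ] E →L[ℝ] ℝ} {z : E} (hG : (G z).IsInvertible)
    (v u : E) : G z (chartChristoffel G z v u) = lowerChristoffel G z v u := by
  obtain ⟨e, he⟩ := hG
  rw [chartChristoffel, ← he, ContinuousLinearMap.inverse_equiv]
  simp

lemma eq_chartChristoffel {G : E → E →L[ℝ] E →L[ℝ] ℝ} {z : E} (hG : (G z).IsInvertible)
    {v u x : E} (hx : ∀ w, G z x w = lowerChristoffel G z v u w) :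
    x = chartChristoffel G z v u := by
  apply hG.injective
  rw [chartChristoffel_spec hG]
  ext w
  exact hx w

/-- Inversion of linear maps is smooth at an invertible map, and the symbols of the first kind are
linear in the derivative of `G`, in `v` and in `u`. The flips in the proof exhibit the term `w ↦
DG(w)(v, u)` as a smooth operator-valued function. -/
lemma contDiffAt_chartChristoffel [FiniteDimensional ℝ E] {G : E → E →L[ℝ] E →L[ℝ] ℝ}
    {q : E × E × E} (hG : ContDiffAt ℝ ∞ G q.1) (hinv : (G q.1).IsInvertible) :
    ContDiffAt ℝ ∞ (fun q : E × E × E ↦ chartChristoffel G q.1 q.2.1 q.2.2) q := by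
  have := FiniteDimensional.complete ℝ E
  have hfst : ContDiffAt ℝ ∞ (fun q : E × E × E ↦ q.1) q := contDiffAt_fst
  have hv : ContDiffAt ℝ ∞ (fun q : E × E × E ↦ q.2.1) q := contDiffAt_fst.comp q contDiffAt_snd
  have hu : ContDiffAt ℝ ∞ (fun q : E × E × E ↦ q.2.2) q := contDiffAt_snd.comp q contDiffAt_snd
  have hD : ContDiffAt ℝ ∞ (fun q : E × E × E ↦ fderiv ℝ G q.1) q :=
    (hG.fderiv_right (m := ∞) (by simp)).comp q hfst
  have hI : ContDiffAt ℝ ∞ (fun q : E × E × E ↦ (G q.1).inverse) q :=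
    ContDiffAt.comp (g := ContinuousLinearMap.inverse) (f := fun q : E × E × E ↦ G q.1) q
      hinv.contDiffAt_map_inverse (hG.comp q hfst)
  refine hI.clm_apply ?_
  have hflip : ContDiffAt ℝ ∞ (fun q : E × E × E ↦ (fderiv ℝ G q.1).flip) q :=
    (ContinuousLinearMap.flipₗᵢ ℝ E E (E →L[ℝ] ℝ)).contDiff.contDiffAt.comp q hD
  have hflip' : ContDiffAt ℝ ∞ (fun q : E × E × E ↦ ((fderiv ℝ G q.1).flip q.2.1).flip) q :=
    (ContinuousLinearMap.flipₗᵢ ℝ E E ℝ).contDiff.contDiffAt.comp q (hflip.clm_apply hv)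
  simp only [lowerChristoffel]
  exact ((((hD.clm_apply hv).clm_apply hu).add
    ((hD.clm_apply hu).clm_apply hv)).sub (hflip'.clm_apply hu)).const_smul (1 / 2 : ℝ)

lemma fderiv_clm_apply₂ {D : Type*} [NormedAddCommGroup D] [NormedSpace ℝ D]
    {G : D → E →L[ℝ] E →L[ℝ] ℝ} {z : D} {v w : D → E} (hG : DifferentiableAt ℝ G z)
    (hv : DifferentiableAt ℝ v z) (hw : DifferentiableAt ℝ w z) (k : D) :
    fderiv ℝ (fun x ↦ G x (v x) (w x)) z k =
      fderiv ℝ G z k (v z) (w z) + G z (fderiv ℝ v z k) (w z) + G z (v z) (fderiv ℝ w z k) := by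
  rw [fderiv_clm_apply (hG.clm_apply hv) hw, fderiv_clm_apply hG hv]
  simp
  ring

lemma fderiv_clm_apply₂_fst {G : E → E →L[ℝ] E →L[ℝ] ℝ} {q : E × E} {v w : E × E → E}
    (hG : DifferentiableAt ℝ G q.1) (hv : DifferentiableAt ℝ v q) (hw : DifferentiableAt ℝ w q)
    (k : E × E) : fderiv ℝ (fun q : E × E ↦ G q.1 (v q) (w q)) q k =
      fderiv ℝ G q.1 k.1 (v q) (w q) + G q.1 (fderiv ℝ v q k) (w q) +
        G q.1 (v q) (fderiv ℝ w q k) := by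
  have h : HasFDerivAt (fun q : E × E ↦ G q.1) _ q := hG.hasFDerivAt.comp q hasFDerivAt_fst
  rw [fderiv_clm_apply₂ h.differentiableAt hv hw, h.fderiv]
  rfl

/-- The transformation law of the Christoffel symbols of the first kind. -/
lemma lowerChristoffel_change {G G' : E → E →L[ℝ] E →L[ℝ] ℝ} {f : E → E} {z : E}
    (hf : ContDiffAt ℝ 2 f z) (hG : DifferentiableAt ℝ G z) (hG' : DifferentiableAt ℝ G' (f z))
    (hsymm : ∀ x v w, G' x v w = G' x w v)
    (h : ∀ᶠ x in 𝓝 z, ∀ v w, G x v w = G' (f x) (fderiv ℝ f x v) (fderiv ℝ f x w)) (v u w : E) :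
    lowerChristoffel G z v u w =
      lowerChristoffel G' (f z) (fderiv ℝ f z v) (fderiv ℝ f z u) (fderiv ℝ f z w) +
        G' (f z) (fderiv ℝ (fderiv ℝ f) z v u) (fderiv ℝ f z w) := by
  have hf1 : DifferentiableAt ℝ f z := hf.differentiableAt (by norm_num)
  have hf2 : DifferentiableAt ℝ (fderiv ℝ f) z :=
    (hf.fderiv_right (m := 1) (by norm_num)).differentiableAt (by norm_num)
  have hfs : ∀ a b, fderiv ℝ (fderiv ℝ f) z a b = fderiv ℝ (fderiv ℝ f) z b a := fun a b ↦
    (hf.isSymmSndFDerivAt (by simp)).eq a b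
  have key : ∀ k a b, fderiv ℝ G z k a b =
      fderiv ℝ G' (f z) (fderiv ℝ f z k) (fderiv ℝ f z a) (fderiv ℝ f z b) +
      G' (f z) (fderiv ℝ (fderiv ℝ f) z k a) (fderiv ℝ f z b) +
      G' (f z) (fderiv ℝ f z a) (fderiv ℝ (fderiv ℝ f) z k b) := by
    intro k a b
    have h1 := fderiv_clm_apply₂ hG (differentiableAt_const a) (differentiableAt_const b) k
    have h2 := fderiv_clm_apply₂ (v := fun x ↦ fderiv ℝ f x a) (w := fun x ↦ fderiv ℝ f x b)
      (hG'.comp z hf1) (hf2.clm_apply (differentiableAt_const a))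
      (hf2.clm_apply (differentiableAt_const b)) k
    have h3 : fderiv ℝ (fun x ↦ G x a b) z k =
        fderiv ℝ (fun x ↦ (G' ∘ f) x (fderiv ℝ f x a) (fderiv ℝ f x b)) z k := by
      congr 1
      exact Filter.EventuallyEq.fderiv_eq (h.mono fun x hx ↦ hx a b)
    rw [h2, fderiv_comp z hG' hf1, fderiv_clm_apply hf2 (differentiableAt_const a),
      fderiv_clm_apply hf2 (differentiableAt_const b)] at h3
    rw [h1] at h3
    simpa using h3
  -- The three metric derivatives contribute six terms with second derivatives of `f`. By symmetry
  -- of the second derivative four of them cancel and the other two are equal, which absorbs the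
  -- factor `1 / 2`.
  rw [lowerChristoffel_apply, lowerChristoffel_apply, key, key, key, hfs u v, hfs w v, hfs w u,
    hsymm (f z) (fderiv ℝ f z v), hsymm (f z) (fderiv ℝ f z u)]
  ring

lemma fderiv_tangentMap {f : E → E} {z : E} (hf : ContDiffAt ℝ 2 f z) (y v w : E) :
    fderiv ℝ (fun q : E × E ↦ (f q.1, fderiv ℝ f q.1 q.2)) (z, y) (v, w) =
      (fderiv ℝ f z v, fderiv ℝ (fderiv ℝ f) z v y + fderiv ℝ f z w) := by
  have hf1 : HasFDerivAt f (fderiv ℝ f z) z := (hf.differentiableAt (by simp)).hasFDerivAt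
  have hf2 : HasFDerivAt (fderiv ℝ f) (fderiv ℝ (fderiv ℝ f) z) z :=
    ((hf.fderiv_right (m := 1) (by norm_num)).differentiableAt (by norm_num)).hasFDerivAt
  have h2 : HasFDerivAt (fun q : E × E ↦ f q.1) _ (z, y) :=
    HasFDerivAt.comp (z, y) hf1 hasFDerivAt_fst
  have h3 : HasFDerivAt (fun q : E × E ↦ fderiv ℝ f q.1) _ (z, y) :=
    HasFDerivAt.comp (z, y) hf2 hasFDerivAt_fst
  rw [(h2.prodMk (h3.clm_apply hasFDerivAt_snd)).fderiv]
  simp [add_comm]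

end ChartCalculus

/-! ### Coordinate changes on `M`, `TM` and `TTM` -/

section TangentCoordinates

variable {E : Type*} [NormedAddCommGroup E] [NormedSpace ℝ E]
  {M : Type*} [TopologicalSpace M] [ChartedSpace E M]

lemma eventually_mem_chart {p q : M} (hq : p ∈ (extChartAt 𝓘(ℝ, E) q).source) :
    ∀ᶠ z in 𝓝 (extChartAt 𝓘(ℝ, E) p p), z ∈ (extChartAt 𝓘(ℝ, E) p).target ∧
      (extChartAt 𝓘(ℝ, E) p).symm z ∈ (extChartAt 𝓘(ℝ, E) q).source := by
  refine Filter.Eventually.and (extChartAt_target_mem_nhds p) ?_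
  refine (continuousAt_extChartAt_symm p).preimage_mem_nhds ?_
  rw [extChartAt_to_inv]
  exact (isOpen_extChartAt_source q).mem_nhds hq

variable [IsManifold 𝓘(ℝ, E) ∞ M]

/-- The change of coordinates from the preferred chart at `p` to the preferred chart at `q`. -/
def transition (p q : M) : E → E :=
  extChartAt 𝓘(ℝ, E) q ∘ (extChartAt 𝓘(ℝ, E) p).symm

/-- The components of a tangent vector at `p` in the preferred chart at `p₀`. -/
def tangentCoord (p₀ p : M) : TangentSpace 𝓘(ℝ, E) p →L[ℝ] E :=
  let e : E →L[ℝ] E := tangentCoordChange 𝓘(ℝ, E) p p₀ p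
  e

/-- The components of a tangent vector of `TM` at `u` in the preferred chart at `u₀`. -/
def tangentCoord₂ (u₀ u : TangentBundle 𝓘(ℝ, E) M) :
    TangentSpace 𝓘(ℝ, E).tangent u →L[ℝ] E × E :=
  let e : E × E →L[ℝ] E × E := tangentCoordChange 𝓘(ℝ, E).tangent u u₀ u
  e

lemma tangentCoord_eq_fderiv (p₀ p : M) :
    (tangentCoord p₀ p : E →L[ℝ] E) =
      fderiv ℝ (transition p p₀) (extChartAt 𝓘(ℝ, E) p p) := by
  rw [tangentCoord, tangentCoordChange_def, ModelWithCorners.range_eq_univ, fderivWithin_univ]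
  rfl

lemma tangentCoordChange_eq_fderiv (p q x : M) : tangentCoordChange 𝓘(ℝ, E) p q x =
    fderiv ℝ (transition p q) (extChartAt 𝓘(ℝ, E) p x) := by
  rw [tangentCoordChange_def, ModelWithCorners.range_eq_univ, fderivWithin_univ]
  rfl

lemma tangentCoord₂_eq_fderiv (u₀ u : TangentBundle 𝓘(ℝ, E) M) :
    (tangentCoord₂ u₀ u : E × E →L[ℝ] E × E) = fderiv ℝ (extChartAt 𝓘(ℝ, E).tangent u₀ ∘
      (extChartAt 𝓘(ℝ, E).tangent u).symm) (extChartAt 𝓘(ℝ, E).tangent u u) := by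
  rw [tangentCoord₂, tangentCoordChange_def, ModelWithCorners.range_eq_univ, fderivWithin_univ]

lemma extChartAt_tangent_apply (u₀ u : TangentBundle 𝓘(ℝ, E) M) :
    extChartAt 𝓘(ℝ, E).tangent u₀ u =
      (extChartAt 𝓘(ℝ, E) u₀.proj u.proj, tangentCoord u₀.proj u.proj u.snd) := rfl

lemma mem_extChartAt_tangent_source {u₀ u : TangentBundle 𝓘(ℝ, E) M} :
    u ∈ (extChartAt 𝓘(ℝ, E).tangent u₀).source ↔ u.proj ∈ (extChartAt 𝓘(ℝ, E) u₀.proj).source := by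
  simp

lemma extChartAt_tangent_symm_apply (u : TangentBundle 𝓘(ℝ, E) M) (q : E × E) :
    (extChartAt 𝓘(ℝ, E).tangent u).symm q =
      (⟨(extChartAt 𝓘(ℝ, E) u.proj).symm q.1,
        tangentCoordChange 𝓘(ℝ, E) u.proj ((extChartAt 𝓘(ℝ, E) u.proj).symm q.1)
          ((extChartAt 𝓘(ℝ, E) u.proj).symm q.1) q.2⟩ : TangentBundle 𝓘(ℝ, E) M) := by
  rfl

lemma tangentCoord_self (p : M) (v : TangentSpace 𝓘(ℝ, E) p) : tangentCoord p p v = v :=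
  tangentCoordChange_self (I := 𝓘(ℝ, E)) (mem_extChartAt_source p)

lemma contDiffAt_transition {p q x : M} (hp : x ∈ (extChartAt 𝓘(ℝ, E) p).source)
    (hq : x ∈ (extChartAt 𝓘(ℝ, E) q).source) :
    ContDiffAt ℝ ∞ (transition p q) (extChartAt 𝓘(ℝ, E) p x) := by
  rw [← contDiffWithinAt_univ, ← ModelWithCorners.range_eq_univ 𝓘(ℝ, E)]
  refine contDiffWithinAt_ext_coord_change q p ?_
  rw [PartialEquiv.trans_source'', PartialEquiv.symm_symm, PartialEquiv.symm_target]
  exact mem_image_of_mem _ ⟨hp, hq⟩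

/-- The cocycle rule for coordinate changes collapses the passage through the moving base point into
a single Jacobian, so a transition map of `TM` is the tangent map of one of `M`. -/
lemma extChartAt_tangent_transition {u u₀ : TangentBundle 𝓘(ℝ, E) M}
    (hu : u.proj ∈ (extChartAt 𝓘(ℝ, E) u₀.proj).source) :
    extChartAt 𝓘(ℝ, E).tangent u₀ ∘ (extChartAt 𝓘(ℝ, E).tangent u).symm
      =ᶠ[𝓝 (extChartAt 𝓘(ℝ, E).tangent u u)] fun q ↦ (transition u.proj u₀.proj q.1,
        fderiv ℝ (transition u.proj u₀.proj) q.1 q.2) := by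
  rw [extChartAt_tangent_apply]
  filter_upwards [continuousAt_fst.eventually (eventually_mem_chart hu)] with q hq
  obtain ⟨h1, h2⟩ := hq
  have h3 := (extChartAt 𝓘(ℝ, E) u.proj).map_target h1
  rw [Function.comp_apply, extChartAt_tangent_symm_apply, extChartAt_tangent_apply]
  refine Prod.ext rfl ?_
  refine (tangentCoordChange_comp (v := q.2) ⟨⟨h3, mem_extChartAt_source _⟩, h2⟩).trans ?_
  rw [tangentCoordChange_eq_fderiv, (extChartAt 𝓘(ℝ, E) u.proj).right_inv h1]

/-- Differentiating the tangent map produces the second derivative of the transition. This is why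
the fibre component of a vector on `TM` is not tensorial until a Christoffel term is added. -/
lemma tangentCoord₂_apply {u u₀ : TangentBundle 𝓘(ℝ, E) M}
    (hu : u.proj ∈ (extChartAt 𝓘(ℝ, E) u₀.proj).source) (v w : E) :
    (tangentCoord₂ u₀ u : E × E →L[ℝ] E × E) (v, w) = ((tangentCoord u₀.proj u.proj : E →L[ℝ] E) v,
      fderiv ℝ (fderiv ℝ (transition u.proj u₀.proj)) (extChartAt 𝓘(ℝ, E) u.proj u.proj) v u.snd
        + (tangentCoord u₀.proj u.proj : E →L[ℝ] E) w) := by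
  have hf : ContDiffAt ℝ 2 (transition u.proj u₀.proj) (extChartAt 𝓘(ℝ, E) u.proj u.proj) :=
    (contDiffAt_transition (mem_extChartAt_source _) hu).of_le ENat.LEInfty.out
  have hq : extChartAt 𝓘(ℝ, E).tangent u u = (extChartAt 𝓘(ℝ, E) u.proj u.proj, u.snd) := by
    rw [extChartAt_tangent_apply, tangentCoord_self]
    rfl
  rw [tangentCoord₂_eq_fderiv, (extChartAt_tangent_transition hu).fderiv_eq, hq,
    tangentCoord_eq_fderiv]
  exact fderiv_tangentMap hf u.snd v w

end TangentCoordinates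

/-! ### The metric and its Christoffel symbols in a fixed chart -/

section ChartMetric

variable {E : Type*} [NormedAddCommGroup E] [NormedSpace ℝ E]
  {M : Type*} [TopologicalSpace M] [ChartedSpace E M] [IsManifold 𝓘(ℝ, E) ∞ M]
  (g : Bundle.ContMDiffRiemannianMetric 𝓘(ℝ, E) ∞ E (fun x : M ↦ TangentSpace 𝓘(ℝ, E) x))

lemma chartMetric_apply {p x : M} (hx : x ∈ (extChartAt 𝓘(ℝ, E) p).source) (v w : E) :
    chartMetric g p (extChartAt 𝓘(ℝ, E) p x) v w =
      gFormE g x (tangentCoordChange 𝓘(ℝ, E) p x x v) (tangentCoordChange 𝓘(ℝ, E) p x x w) := by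
  -- The base point occurs in the types, so the equality is stated for every `y = x` and can be used
  -- before and after rewriting by `left_inv`.
  have h : ∀ y, y = x →
      ((trivializationAt E (TangentSpace 𝓘(ℝ, E)) p).symmL ℝ y : E →L[ℝ] E) =
        tangentCoordChange 𝓘(ℝ, E) p y y := by
    rintro y rfl
    rw [extChartAt_source] at hx
    exact TangentBundle.symmL_trivializationAt_eq_core hx
  have hl := (extChartAt 𝓘(ℝ, E) p).left_inv hx
  have h' := h _ hl
  change gFormE g ((extChartAt 𝓘(ℝ, E) p).symm (extChartAt 𝓘(ℝ, E) p x))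
    ((trivializationAt E (TangentSpace 𝓘(ℝ, E)) p).symmL ℝ
      ((extChartAt 𝓘(ℝ, E) p).symm (extChartAt 𝓘(ℝ, E) p x)) v : E)
    ((trivializationAt E (TangentSpace 𝓘(ℝ, E)) p).symmL ℝ
      ((extChartAt 𝓘(ℝ, E) p).symm (extChartAt 𝓘(ℝ, E) p x)) w : E) = _
  rw [hl]
  rw [← h x rfl]
  rfl

lemma chartMetric_tangentCoord {p₀ p : M} (hp : p ∈ (extChartAt 𝓘(ℝ, E) p₀).source)
    (v w : TangentSpace 𝓘(ℝ, E) p) :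
    chartMetric g p₀ (extChartAt 𝓘(ℝ, E) p₀ p) (tangentCoord p₀ p v) (tangentCoord p₀ p w) =
      g.inner p v w := by
  rw [chartMetric_apply g hp]
  have h : ∀ v : TangentSpace 𝓘(ℝ, E) p,
      tangentCoordChange 𝓘(ℝ, E) p₀ p p (tangentCoord p₀ p v) = v := fun v ↦
    (tangentCoordChange_comp (I := 𝓘(ℝ, E)) (v := v)
      ⟨⟨mem_extChartAt_source p, hp⟩, mem_extChartAt_source p⟩).trans
      (tangentCoordChange_self (I := 𝓘(ℝ, E)) (mem_extChartAt_source p))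
  rw [h, h]
  rfl

lemma tangentCoord_surjective {p₀ p : M} (hp : p ∈ (extChartAt 𝓘(ℝ, E) p₀).source) :
    Function.Surjective (tangentCoord p₀ p : E →L[ℝ] E) := fun w ↦
  ⟨tangentCoordChange 𝓘(ℝ, E) p₀ p p w,
    (tangentCoordChange_comp (I := 𝓘(ℝ, E)) ⟨⟨hp, mem_extChartAt_source p⟩, hp⟩).trans
      (tangentCoordChange_self hp)⟩

lemma chartMetric_self (p : M) (v w : E) :
    chartMetric g p (extChartAt 𝓘(ℝ, E) p p) v w = gFormE g p v w := by
  exact (congrArg₂ (fun a b : E ↦ chartMetric g p (extChartAt 𝓘(ℝ, E) p p) a b)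
    (tangentCoord_self p v).symm (tangentCoord_self p w).symm).trans
      (chartMetric_tangentCoord g (mem_extChartAt_source p) v w)

lemma chartMetric_transition {p₀ p x : M} (hx : x ∈ (extChartAt 𝓘(ℝ, E) p).source)
    (hx₀ : x ∈ (extChartAt 𝓘(ℝ, E) p₀).source) (v w : E) :
    chartMetric g p (extChartAt 𝓘(ℝ, E) p x) v w =
      chartMetric g p₀ (transition p p₀ (extChartAt 𝓘(ℝ, E) p x))
        (fderiv ℝ (transition p p₀) (extChartAt 𝓘(ℝ, E) p x) v)
        (fderiv ℝ (transition p p₀) (extChartAt 𝓘(ℝ, E) p x) w) := by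
  have h : ∀ v : E, tangentCoordChange 𝓘(ℝ, E) p₀ x x
      (fderiv ℝ (transition p p₀) (extChartAt 𝓘(ℝ, E) p x) v) =
      tangentCoordChange 𝓘(ℝ, E) p x x v := fun v ↦ by
    rw [← tangentCoordChange_eq_fderiv]
    exact tangentCoordChange_comp (I := 𝓘(ℝ, E)) ⟨⟨hx, hx₀⟩, mem_extChartAt_source x⟩
  have h' : transition p p₀ (extChartAt 𝓘(ℝ, E) p x) = extChartAt 𝓘(ℝ, E) p₀ x := by
    rw [transition, Function.comp_apply, (extChartAt 𝓘(ℝ, E) p).left_inv hx]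
  rw [h', chartMetric_apply g hx, chartMetric_apply g hx₀, h, h]

lemma chartMetric_pos {p : M} {z : E} (hz : z ∈ (extChartAt 𝓘(ℝ, E) p).target) {v : E}
    (hv : v ≠ 0) : 0 < chartMetric g p z v v := by
  have hx := (extChartAt 𝓘(ℝ, E) p).map_target hz
  rw [← (extChartAt 𝓘(ℝ, E) p).right_inv hz, chartMetric_apply g hx]
  refine g.pos _ _ fun h ↦ hv ?_
  have h1 := tangentCoordChange_comp (I := 𝓘(ℝ, E)) (v := v)
    ⟨⟨hx, mem_extChartAt_source ((extChartAt 𝓘(ℝ, E) p).symm z)⟩, hx⟩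
  rw [tangentCoordChange_self hx] at h1
  rw [← h1]
  have h2 : tangentCoordChange 𝓘(ℝ, E) p ((extChartAt 𝓘(ℝ, E) p).symm z)
    ((extChartAt 𝓘(ℝ, E) p).symm z) v = (0 : E) := h
  rw [h2, map_zero]

variable [FiniteDimensional ℝ E]

/-- In finite dimension an operator-valued map is smooth once its values on fixed vectors are. On
fixed `v`, `w` it is the smooth metric applied to the sections with constant components in the
trivialization at `p`. -/
lemma contDiffAt_chartMetric {p : M} {z : E} (hz : z ∈ (extChartAt 𝓘(ℝ, E) p).target) :
    ContDiffAt ℝ ∞ (chartMetric g p) z := by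
  have hopen := isOpen_extChartAt_target (I := 𝓘(ℝ, E)) p
  suffices h : ContDiffOn ℝ ∞ (chartMetric g p) (extChartAt 𝓘(ℝ, E) p).target from
    h.contDiffAt (hopen.mem_nhds hz)
  rw [contDiffOn_clm_apply]
  intro v
  rw [contDiffOn_clm_apply]
  intro w
  have hsymm : ContMDiffOn 𝓘(ℝ, E) 𝓘(ℝ, E) ∞ (extChartAt 𝓘(ℝ, E) p).symm
      (extChartAt 𝓘(ℝ, E) p).target := contMDiffOn_extChartAt_symm p
  let e := trivializationAt E (TangentSpace 𝓘(ℝ, E)) p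
  have hv : ∀ v : E, ContMDiffOn 𝓘(ℝ, E) 𝓘(ℝ, E).tangent ∞
      (fun x : M ↦ (⟨x, e.symmL ℝ x v⟩ : TangentBundle 𝓘(ℝ, E) M)) e.baseSet := by
    intro v
    rw [Bundle.Trivialization.contMDiffOn_section_baseSet_iff]
    refine (contMDiffOn_const (c := v)).congr fun x hx ↦ ?_
    simp [hx]
  have hin : ContMDiffOn 𝓘(ℝ, E) 𝓘(ℝ, ℝ) ∞ (fun x : M ↦ g.inner x (e.symmL ℝ x v) (e.symmL ℝ x w)) e.baseSet := by
    intro x hx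
    have h := ContMDiffWithinAt.clm_bundle_apply₂ (b := fun x : M ↦ x) (F₁ := E) (F₂ := E)
      (F₃ := ℝ) (E₃ := Bundle.Trivial M ℝ) (ψ := fun x ↦ g.inner x)
      (g.contMDiff.contMDiffAt.contMDiffWithinAt) (hv v x hx) (hv w x hx)
    rw [Bundle.contMDiffWithinAt_totalSpace] at h
    exact h.2
  refine contMDiffOn_iff_contDiffOn.1 ((hin.comp hsymm ?_).congr ?_)
  · intro x hx
    simpa [e] using (extChartAt 𝓘(ℝ, E) p).map_target hx
  · intro x hx
    rfl

/-- The transformation law of the Christoffel symbols. -/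
lemma chartChristoffel_tangentCoord {p₀ p : M} (hp : p ∈ (extChartAt 𝓘(ℝ, E) p₀).source)
    (v u : E) :
    chartChristoffel (chartMetric g p₀) (extChartAt 𝓘(ℝ, E) p₀ p)
        ((tangentCoord p₀ p : E →L[ℝ] E) v) ((tangentCoord p₀ p : E →L[ℝ] E) u) =
      (tangentCoord p₀ p : E →L[ℝ] E) (christoffel g p v u) -
        fderiv ℝ (fderiv ℝ (transition p p₀)) (extChartAt 𝓘(ℝ, E) p p) v u := by
  have hz₀ := (extChartAt 𝓘(ℝ, E) p₀).map_source hp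
  have hT : transition p p₀ (extChartAt 𝓘(ℝ, E) p p) = extChartAt 𝓘(ℝ, E) p₀ p := by
    rw [transition, Function.comp_apply, extChartAt_to_inv]
  have hinv : (chartMetric g p₀ (extChartAt 𝓘(ℝ, E) p₀ p)).IsInvertible :=
    ContinuousLinearMap.isInvertible_of_pos fun v hv ↦ chartMetric_pos g hz₀ hv
  symm
  -- By nondegeneracy it suffices to pair with test vectors. These can be taken of the form
  -- `tangentCoord p₀ p w`, and the claim becomes the law for the symbols of the first kind.
  refine eq_chartChristoffel hinv fun w ↦ ?_
  obtain ⟨w, rfl⟩ := tangentCoord_surjective hp w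
  have key := lowerChristoffel_change (G := chartMetric g p) (G' := chartMetric g p₀)
    (f := transition p p₀) (z := extChartAt 𝓘(ℝ, E) p p)
    ((contDiffAt_transition (mem_extChartAt_source _) hp).of_le ENat.LEInfty.out)
    ((contDiffAt_chartMetric g (mem_extChartAt_target p)).differentiableAt (by simp))
    (by rw [hT]; exact (contDiffAt_chartMetric g hz₀).differentiableAt (by simp))
    (chartMetric_symm g p₀)
    (by
      filter_upwards [eventually_mem_chart hp] with z hz v w
      have h := chartMetric_transition g ((extChartAt 𝓘(ℝ, E) p).map_target hz.1) hz.2 v w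
      rwa [(extChartAt 𝓘(ℝ, E) p).right_inv hz.1] at h) v u w
  rw [hT, ← tangentCoord_eq_fderiv] at key
  rw [map_sub, sub_apply, sub_eq_iff_eq_add]
  refine Eq.trans ?_ key
  refine (chartMetric_tangentCoord g hp (christoffel g p v u) w).trans ?_
  exact (gFormE_christoffel g p v u w).trans (lowerChristoffel_apply _ _ v u w).symm

lemma contDiffAt_chartChristoffel_chartMetric {p : M} {q : E × E × E}
    (hq : q.1 ∈ (extChartAt 𝓘(ℝ, E) p).target) :
    ContDiffAt ℝ ∞ (fun q : E × E × E ↦ chartChristoffel (chartMetric g p) q.1 q.2.1 q.2.2) q :=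
  contDiffAt_chartChristoffel (contDiffAt_chartMetric g hq)
    (ContinuousLinearMap.isInvertible_of_pos fun _ hv ↦ chartMetric_pos g hq hv)

end ChartMetric

/-! ### Smoothness of lifts and components in a fixed chart of `TM` -/

section SmoothSections

variable {E : Type*} [NormedAddCommGroup E] [NormedSpace ℝ E]
  {M : Type*} [TopologicalSpace M] [ChartedSpace E M] [IsManifold 𝓘(ℝ, E) ∞ M]
  {u₀ : TangentBundle 𝓘(ℝ, E) M}

/-- The section `v` along the projection `TM → M` is smooth at `u₀`. -/
def SmoothSectionAt (v : ∀ u : TangentBundle 𝓘(ℝ, E) M, TangentSpace 𝓘(ℝ, E) u.proj)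
    (u₀ : TangentBundle 𝓘(ℝ, E) M) : Prop :=
  ContMDiffAt 𝓘(ℝ, E).tangent 𝓘(ℝ, E) ∞ (fun u ↦ tangentCoord u₀.proj u.proj (v u)) u₀

/-- The vector field `X` on `TM` is smooth at `u₀`. -/
def SmoothFieldAt (X : ∀ u : TangentBundle 𝓘(ℝ, E) M, TangentSpace 𝓘(ℝ, E).tangent u)
    (u₀ : TangentBundle 𝓘(ℝ, E) M) : Prop :=
  ContMDiffAt 𝓘(ℝ, E).tangent 𝓘(ℝ, E × E) ∞ (fun u ↦ tangentCoord₂ u₀ u (X u)) u₀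

lemma smoothFieldAt_iff {X : ∀ u : TangentBundle 𝓘(ℝ, E) M, TangentSpace 𝓘(ℝ, E).tangent u} :
    SmoothFieldAt X u₀ ↔ ContMDiffAt 𝓘(ℝ, E).tangent 𝓘(ℝ, E).tangent.tangent ∞
      (fun u ↦ (⟨u, X u⟩ : TangentBundle 𝓘(ℝ, E).tangent (TangentBundle 𝓘(ℝ, E) M))) u₀ :=
  (Bundle.contMDiffAt_section (IB := 𝓘(ℝ, E).tangent) (F := E × E)
    (E := TangentSpace 𝓘(ℝ, E).tangent) (s := X) u₀).symm

lemma SmoothField.smoothFieldAt {U : Set (TangentBundle 𝓘(ℝ, E) M)}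
    {X : ∀ u : TangentBundle 𝓘(ℝ, E) M, TangentSpace 𝓘(ℝ, E).tangent u}
    (hX : SmoothField 𝓘(ℝ, E).tangent U X) (hU : IsOpen U) (hu : u₀ ∈ U) : SmoothFieldAt X u₀ :=
  smoothFieldAt_iff.2 (hX.contMDiffAt (hU.mem_nhds hu))

lemma smoothField_of_smoothFieldAt {U : Set (TangentBundle 𝓘(ℝ, E) M)}
    {X : ∀ u : TangentBundle 𝓘(ℝ, E) M, TangentSpace 𝓘(ℝ, E).tangent u}
    (hX : ∀ u ∈ U, SmoothFieldAt X u) : SmoothField 𝓘(ℝ, E).tangent U X :=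
  fun u hu ↦ (smoothFieldAt_iff.1 (hX u hu)).contMDiffWithinAt

variable {v w : ∀ u : TangentBundle 𝓘(ℝ, E) M, TangentSpace 𝓘(ℝ, E) u.proj}

lemma SmoothSectionAt.add (hv : SmoothSectionAt v u₀) (hw : SmoothSectionAt w u₀) :
    SmoothSectionAt (fun u ↦ v u + w u) u₀ := by
  unfold SmoothSectionAt
  simp only [map_add]
  exact ContMDiffAt.add hv hw

lemma SmoothSectionAt.smul {f : TangentBundle 𝓘(ℝ, E) M → ℝ}
    (hf : ContMDiffAt 𝓘(ℝ, E).tangent 𝓘(ℝ, ℝ) ∞ f u₀) (hv : SmoothSectionAt v u₀) :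
    SmoothSectionAt (fun u ↦ f u • v u) u₀ := by
  unfold SmoothSectionAt
  simp only [map_smul]
  exact ContMDiffAt.smul hf hv

lemma SmoothFieldAt.add {X Y : ∀ u : TangentBundle 𝓘(ℝ, E) M, TangentSpace 𝓘(ℝ, E).tangent u}
    (hX : SmoothFieldAt X u₀) (hY : SmoothFieldAt Y u₀) :
    SmoothFieldAt (fun u ↦ X u + Y u) u₀ := by
  unfold SmoothFieldAt
  simp only [map_add]
  exact ContMDiffAt.add hX hY

lemma contMDiffAt_extChartAt_tangent : ContMDiffAt 𝓘(ℝ, E).tangent 𝓘(ℝ, E × E) ∞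
    (fun u : TangentBundle 𝓘(ℝ, E) M ↦ (extChartAt 𝓘(ℝ, E) u₀.proj u.proj,
      tangentCoord u₀.proj u.proj u.snd)) u₀ :=
  contMDiffAt_extChartAt (I := 𝓘(ℝ, E).tangent)

lemma contMDiffAt_baseCoord : ContMDiffAt 𝓘(ℝ, E).tangent 𝓘(ℝ, E) ∞
    (fun u : TangentBundle 𝓘(ℝ, E) M ↦ extChartAt 𝓘(ℝ, E) u₀.proj u.proj) u₀ :=
  contDiff_fst.contDiffAt.comp_contMDiffAt contMDiffAt_extChartAt_tangent

lemma smoothSectionAt_snd :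
    SmoothSectionAt (fun u : TangentBundle 𝓘(ℝ, E) M ↦ u.snd) u₀ :=
  contDiff_snd.contDiffAt.comp_contMDiffAt contMDiffAt_extChartAt_tangent

lemma eventually_proj_mem_source : ∀ᶠ u : TangentBundle 𝓘(ℝ, E) M in 𝓝 u₀,
    u.proj ∈ (extChartAt 𝓘(ℝ, E) u₀.proj).source :=
  ((isOpen_extChartAt_source u₀.proj).preimage
    (FiberBundle.continuous_proj E (TangentSpace 𝓘(ℝ, E)))).mem_nhds (mem_extChartAt_source _)

lemma hComp_vLift (u : TangentBundle 𝓘(ℝ, E) M) (v : TangentSpace 𝓘(ℝ, E) u.proj) :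
    hComp u (vLift u v) = 0 := rfl

lemma SmoothFieldAt.hComp {X : ∀ u : TangentBundle 𝓘(ℝ, E) M, TangentSpace 𝓘(ℝ, E).tangent u}
    (hX : SmoothFieldAt X u₀) : SmoothSectionAt (fun u ↦ hComp u (X u)) u₀ := by
  refine (contDiff_fst.contDiffAt.comp_contMDiffAt hX).congr_of_eventuallyEq ?_
  filter_upwards [eventually_proj_mem_source] with u hu
  exact (congrArg Prod.fst (tangentCoord₂_apply hu (Prod.fst (α := E) (β := E) (X u))
    (Prod.snd (α := E) (β := E) (X u)))).symm

lemma SmoothSectionAt.vLift (hv : SmoothSectionAt v u₀) :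
    SmoothFieldAt (fun u ↦ vLift u (v u)) u₀ := by
  refine (ContMDiffAt.prodMk_space (contMDiffAt_const (c := (0 : E))) hv).congr_of_eventuallyEq ?_
  filter_upwards [eventually_proj_mem_source] with u hu
  refine (tangentCoord₂_apply hu 0 (v u)).trans ?_
  have h : ∀ (z y : E), fderiv ℝ (fderiv ℝ (transition u.proj u₀.proj)) z 0 y = 0 := by simp
  exact Prod.ext (map_zero (tangentCoord u₀.proj u.proj))
    ((congrArg (· + _) (h _ u.snd)).trans (zero_add _))

variable [FiniteDimensional ℝ E]
  (g : Bundle.ContMDiffRiemannianMetric 𝓘(ℝ, E) ∞ E (fun x : M ↦ TangentSpace 𝓘(ℝ, E) x))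

lemma SmoothSectionAt.inner (hv : SmoothSectionAt v u₀) (hw : SmoothSectionAt w u₀) :
    ContMDiffAt 𝓘(ℝ, E).tangent 𝓘(ℝ, ℝ) ∞ (fun u ↦ gForm g u.proj (v u) (w u)) u₀ := by
  have h : ContMDiffAt 𝓘(ℝ, E).tangent 𝓘(ℝ, E →L[ℝ] E →L[ℝ] ℝ) ∞
      (fun u : TangentBundle 𝓘(ℝ, E) M ↦
        chartMetric g u₀.proj (extChartAt 𝓘(ℝ, E) u₀.proj u.proj)) u₀ :=
    ContDiffAt.comp_contMDiffAt (g := chartMetric g u₀.proj)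
      (contDiffAt_chartMetric g (mem_extChartAt_target u₀.proj)) contMDiffAt_baseCoord
  refine ((h.clm_apply hv).clm_apply hw).congr_of_eventuallyEq ?_
  filter_upwards [eventually_proj_mem_source] with u hu
  exact (chartMetric_tangentCoord g hu (v u) (w u)).symm

/-- The components of a tangent vector of `TM` in terms of its horizontal and vertical parts. -/
lemma tangentCoord₂_eq {u : TangentBundle 𝓘(ℝ, E) M}
    (hu : u.proj ∈ (extChartAt 𝓘(ℝ, E) u₀.proj).source) (w : TangentSpace 𝓘(ℝ, E).tangent u) :
    tangentCoord₂ u₀ u w = (tangentCoord u₀.proj u.proj (hComp u w),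
      tangentCoord u₀.proj u.proj (vComp g u w) -
        chartChristoffel (chartMetric g u₀.proj) (extChartAt 𝓘(ℝ, E) u₀.proj u.proj)
          (tangentCoord u₀.proj u.proj (hComp u w)) (tangentCoord u₀.proj u.proj u.snd)) := by
  obtain ⟨a, b⟩ := w
  refine (tangentCoord₂_apply hu a b).trans ?_
  refine Prod.ext rfl ?_
  have h : tangentCoord u₀.proj u.proj (vComp g u ((a, b) : E × E)) =
      (tangentCoord u₀.proj u.proj : E →L[ℝ] E) b +
        (tangentCoord u₀.proj u.proj : E →L[ℝ] E) (christoffel g u.proj a u.snd) :=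
    (tangentCoord u₀.proj u.proj : E →L[ℝ] E).map_add b _
  -- The second derivative terms of the two transformation laws are equal and cancel.
  have h' := chartChristoffel_tangentCoord g hu a u.snd
  simp only
  refine Eq.trans ?_ (congrArg₂ (· - ·) h.symm h'.symm)
  abel

lemma contMDiffAt_chartChristoffel (hv : SmoothSectionAt v u₀) (hw : SmoothSectionAt w u₀) :
    ContMDiffAt 𝓘(ℝ, E).tangent 𝓘(ℝ, E) ∞ (fun u : TangentBundle 𝓘(ℝ, E) M ↦
      chartChristoffel (chartMetric g u₀.proj) (extChartAt 𝓘(ℝ, E) u₀.proj u.proj)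
        (tangentCoord u₀.proj u.proj (v u)) (tangentCoord u₀.proj u.proj (w u))) u₀ :=
  ContDiffAt.comp_contMDiffAt
    (g := fun q : E × E × E ↦ chartChristoffel (chartMetric g u₀.proj) q.1 q.2.1 q.2.2)
    (f := fun u : TangentBundle 𝓘(ℝ, E) M ↦ (extChartAt 𝓘(ℝ, E) u₀.proj u.proj,
      (tangentCoord u₀.proj u.proj (v u), tangentCoord u₀.proj u.proj (w u))))
    (contDiffAt_chartChristoffel_chartMetric g (mem_extChartAt_target u₀.proj))
    (contMDiffAt_baseCoord.prodMk_space (ContMDiffAt.prodMk_space hv hw))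

/-- By `tangentCoord₂_eq`, in the fixed chart at `u₀` the vertical component is the fibre component
plus a Christoffel term, and both depend smoothly on the point. -/
lemma SmoothFieldAt.vComp {X : ∀ u : TangentBundle 𝓘(ℝ, E) M, TangentSpace 𝓘(ℝ, E).tangent u}
    (hX : SmoothFieldAt X u₀) : SmoothSectionAt (fun u ↦ vComp g u (X u)) u₀ := by
  have h := contMDiffAt_chartChristoffel g hX.hComp smoothSectionAt_snd
  refine ((contDiff_snd.contDiffAt.comp_contMDiffAt hX).add h).congr_of_eventuallyEq ?_
  filter_upwards [eventually_proj_mem_source] with u hu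
  have := congrArg Prod.snd (tangentCoord₂_eq g hu (X u))
  refine (eq_sub_iff_add_eq.1 this).symm

lemma hComp_hLift (u : TangentBundle 𝓘(ℝ, E) M) (v : TangentSpace 𝓘(ℝ, E) u.proj) :
    hComp u (hLift g u v) = v := rfl

lemma vComp_hLift (u : TangentBundle 𝓘(ℝ, E) M) (v : TangentSpace 𝓘(ℝ, E) u.proj) :
    vComp g u (hLift g u v) = 0 :=
  neg_add_cancel (christoffel g u.proj v u.snd)

lemma vComp_vLift (u : TangentBundle 𝓘(ℝ, E) M) (v : TangentSpace 𝓘(ℝ, E) u.proj) :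
    vComp g u (vLift u v) = v := by
  have h : ∀ w y : E, w + christoffel g u.proj (0 : E) y = w := by simp
  exact h v u.snd

lemma SmoothSectionAt.hLift (hv : SmoothSectionAt v u₀) :
    SmoothFieldAt (fun u ↦ hLift g u (v u)) u₀ := by
  have h := contMDiffAt_chartChristoffel g hv smoothSectionAt_snd
  refine (ContMDiffAt.prodMk_space hv h.neg).congr_of_eventuallyEq ?_
  filter_upwards [eventually_proj_mem_source] with u hu
  rw [tangentCoord₂_eq g hu, vComp_hLift, hComp_hLift, map_zero, zero_sub]

end SmoothSections

/-! ### Derivatives, Lie brackets and the radial 1-forms on `TM` -/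

section ChartDerivatives

variable {E : Type*} [NormedAddCommGroup E] [NormedSpace ℝ E]
  {M : Type*} [TopologicalSpace M] [ChartedSpace E M] [IsManifold 𝓘(ℝ, E) ∞ M]
  {u : TangentBundle 𝓘(ℝ, E) M}

lemma extChartAt_tangent_self : extChartAt 𝓘(ℝ, E).tangent u u =
    (extChartAt 𝓘(ℝ, E) u.proj u.proj, u.snd) := by
  rw [extChartAt_tangent_apply, tangentCoord_self]
  rfl

/-- The components of the vector field `X` on `TM` in the preferred chart at `u`. -/
def fieldInChart (u : TangentBundle 𝓘(ℝ, E) M)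
    (X : ∀ u : TangentBundle 𝓘(ℝ, E) M, TangentSpace 𝓘(ℝ, E).tangent u) (q : E × E) : E × E :=
  tangentCoord₂ u ((extChartAt 𝓘(ℝ, E).tangent u).symm q) (X ((extChartAt 𝓘(ℝ, E).tangent u).symm q))

lemma tangentCoord₂_self (w : TangentSpace 𝓘(ℝ, E).tangent u) : tangentCoord₂ u u w = w :=
  tangentCoordChange_self (I := 𝓘(ℝ, E).tangent) (mem_extChartAt_source u)

lemma fieldInChart_self
    (X : ∀ u : TangentBundle 𝓘(ℝ, E) M, TangentSpace 𝓘(ℝ, E).tangent u) :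
    fieldInChart u X (extChartAt 𝓘(ℝ, E).tangent u u) = X u := by
  rw [fieldInChart, extChartAt_to_inv, tangentCoord₂_self]

lemma contMDiffAt_extChartAt_tangent_symm :
    ContMDiffAt 𝓘(ℝ, E × E) 𝓘(ℝ, E).tangent ∞ (extChartAt 𝓘(ℝ, E).tangent u).symm
      (extChartAt 𝓘(ℝ, E).tangent u u) :=
  (contMDiffOn_extChartAt_symm u).contMDiffAt (extChartAt_target_mem_nhds u)

lemma ContMDiffAt.contDiffAt_comp_extChartAt_symm {F : Type*} [NormedAddCommGroup F]
    [NormedSpace ℝ F] {f : TangentBundle 𝓘(ℝ, E) M → F}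
    (hf : ContMDiffAt 𝓘(ℝ, E).tangent 𝓘(ℝ, F) ∞ f u) :
    ContDiffAt ℝ ∞ (fun q ↦ f ((extChartAt 𝓘(ℝ, E).tangent u).symm q))
      (extChartAt 𝓘(ℝ, E).tangent u u) := by
  rw [← contMDiffAt_iff_contDiffAt]
  refine ContMDiffAt.comp_of_eq hf contMDiffAt_extChartAt_tangent_symm ?_
  rw [extChartAt_to_inv]

lemma SmoothFieldAt.contDiffAt_fieldInChart
    {X : ∀ u : TangentBundle 𝓘(ℝ, E) M, TangentSpace 𝓘(ℝ, E).tangent u} (hX : SmoothFieldAt X u) :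
    ContDiffAt ℝ ∞ (fieldInChart u X) (extChartAt 𝓘(ℝ, E).tangent u u) :=
  ContMDiffAt.contDiffAt_comp_extChartAt_symm hX

lemma mvfderiv_eq_fderiv {f : TangentBundle 𝓘(ℝ, E) M → ℝ}
    (hf : ContMDiffAt 𝓘(ℝ, E).tangent 𝓘(ℝ, ℝ) ∞ f u) (w : TangentSpace 𝓘(ℝ, E).tangent u) :
    mvfderiv 𝓘(ℝ, E).tangent f u w =
      (fderiv ℝ (fun q ↦ f ((extChartAt 𝓘(ℝ, E).tangent u).symm q))
        (extChartAt 𝓘(ℝ, E).tangent u u) : E × E →L[ℝ] ℝ) w := by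
  have h := (hf.mdifferentiableAt (by simp)).mvfderiv
  rw [ModelWithCorners.range_eq_univ, fderivWithin_univ] at h
  exact congrArg (fun l : E × E →L[ℝ] ℝ ↦ l w) h

/-- Identifies the pullback used in the definition of the manifold Lie bracket with `fieldInChart`,
so that brackets can be computed in `E × E`. -/
lemma tangentCoord₂_eq_inverse {q : E × E} (hq : q ∈ (extChartAt 𝓘(ℝ, E).tangent u).target)
    (w : TangentSpace 𝓘(ℝ, E).tangent ((extChartAt 𝓘(ℝ, E).tangent u).symm q)) :
    (mfderivWithin 𝓘(ℝ, E × E) 𝓘(ℝ, E).tangent (extChartAt 𝓘(ℝ, E).tangent u).symm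
      (range 𝓘(ℝ, E).tangent) q).inverse w =
      tangentCoord₂ u ((extChartAt 𝓘(ℝ, E).tangent u).symm q) w := by
  have h1 := mfderiv_extChartAt_comp_mfderivWithin_extChartAt_symm hq
  have h2 := mfderivWithin_extChartAt_symm_comp_mfderiv_extChartAt hq
  have hs := (extChartAt 𝓘(ℝ, E).tangent u).map_target hq
  rw [extChartAt_source] at hs
  rw [ContinuousLinearMap.inverse_eq h2 h1,
    ← TangentBundle.continuousLinearMapAt_trivializationAt hs,
    TangentBundle.continuousLinearMapAt_trivializationAt_eq_core hs]
  rfl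

lemma extChartAt_tangent_symm_self {u' : TangentBundle 𝓘(ℝ, E) M}
    (hu' : u'.proj ∈ (extChartAt 𝓘(ℝ, E) u.proj).source) :
    (extChartAt 𝓘(ℝ, E).tangent u).symm (extChartAt 𝓘(ℝ, E).tangent u u') = u' :=
  (extChartAt 𝓘(ℝ, E).tangent u).left_inv (mem_extChartAt_tangent_source.2 hu')

lemma eventually_of_forall_chart {P : E × E → Prop}
    (h : ∀ u' : TangentBundle 𝓘(ℝ, E) M, u'.proj ∈ (extChartAt 𝓘(ℝ, E) u.proj).source →
      P (extChartAt 𝓘(ℝ, E).tangent u u')) :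
    ∀ᶠ q in 𝓝 (extChartAt 𝓘(ℝ, E).tangent u u), P q := by
  filter_upwards [extChartAt_target_mem_nhds u] with q hq
  have h1 := (extChartAt 𝓘(ℝ, E).tangent u).map_target hq
  rw [← (extChartAt 𝓘(ℝ, E).tangent u).right_inv hq]
  exact h _ (mem_extChartAt_tangent_source.1 h1)

/-- The energy density in a chart. -/
def chartEnergy (G : E → E →L[ℝ] E →L[ℝ] ℝ) (q : E × E) : ℝ := (1 / 2 : ℝ) * G q.1 q.2 q.2

lemma fderiv_chartEnergy {G : E → E →L[ℝ] E →L[ℝ] ℝ} {q : E × E} (hG : DifferentiableAt ℝ G q.1)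
    (hs : ∀ v w, G q.1 v w = G q.1 w v) (k : E × E) :
    fderiv ℝ (chartEnergy G) q k =
      (1 / 2 : ℝ) * fderiv ℝ G q.1 k.1 q.2 q.2 + G q.1 k.2 q.2 := by
  have hd : DifferentiableAt ℝ (fun q : E × E ↦ G q.1 q.2 q.2) q :=
    ((hG.comp q differentiableAt_fst).clm_apply differentiableAt_snd).clm_apply
      differentiableAt_snd
  have h := fderiv_clm_apply₂_fst hG differentiableAt_snd differentiableAt_snd k
  unfold chartEnergy
  rw [fderiv_const_mul hd, smul_apply, h, fderiv_snd]
  simp only [ContinuousLinearMap.coe_snd', smul_eq_mul]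
  rw [hs q.2 k.2]
  ring

variable (g : Bundle.ContMDiffRiemannianMetric 𝓘(ℝ, E) ∞ E (fun x : M ↦ TangentSpace 𝓘(ℝ, E) x))

lemma energy_eq_chartEnergy {u' : TangentBundle 𝓘(ℝ, E) M}
    (hu' : u'.proj ∈ (extChartAt 𝓘(ℝ, E) u.proj).source) :
    energy g u' = chartEnergy (chartMetric g u.proj) (extChartAt 𝓘(ℝ, E).tangent u u') := by
  rw [extChartAt_tangent_apply, chartEnergy, chartMetric_tangentCoord g hu', energy]

lemma mlieBracket_eq
    (X Y : ∀ u : TangentBundle 𝓘(ℝ, E) M, TangentSpace 𝓘(ℝ, E).tangent u) :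
    VectorField.mlieBracket 𝓘(ℝ, E).tangent X Y u =
      VectorField.lieBracket ℝ (fieldInChart u X) (fieldInChart u Y)
        (extChartAt 𝓘(ℝ, E).tangent u u) := by
  have key : ∀ X : ∀ u : TangentBundle 𝓘(ℝ, E) M, TangentSpace 𝓘(ℝ, E).tangent u,
      (VectorField.mpullbackWithin 𝓘(ℝ, E × E) 𝓘(ℝ, E).tangent
        (extChartAt 𝓘(ℝ, E).tangent u).symm X (range 𝓘(ℝ, E).tangent) : E × E → E × E)
      =ᶠ[𝓝 (extChartAt 𝓘(ℝ, E).tangent u u)] fieldInChart u X := by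
    intro X
    filter_upwards [extChartAt_target_mem_nhds u] with q hq
    exact tangentCoord₂_eq_inverse hq _
  rw [← VectorField.mlieBracketWithin_univ, VectorField.mlieBracketWithin_apply,
    mfderiv_extChartAt_self, preimage_univ, univ_inter, ModelWithCorners.range_eq_univ]
  have h := (key X).lieBracket_vectorField_eq (𝕜 := ℝ) (key Y)
  rw [ModelWithCorners.range_eq_univ] at h
  refine Eq.trans ?_ h
  refine (congrArg (fun l : E × E →L[ℝ] E × E ↦ l _) ContinuousLinearMap.inverse_id).trans ?_
  exact congrFun VectorField.lieBracketWithin_univ _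

lemma energy_comp_symm : (fun q ↦ energy g ((extChartAt 𝓘(ℝ, E).tangent u).symm q)) =ᶠ[
    𝓝 (extChartAt 𝓘(ℝ, E).tangent u u)] chartEnergy (chartMetric g u.proj) :=
  eventually_of_forall_chart fun u' hu' ↦ by
    beta_reduce
    rw [extChartAt_tangent_symm_self hu', energy_eq_chartEnergy g hu']

variable [FiniteDimensional ℝ E]

/-- Metric compatibility: for two equal arguments the Christoffel term `g (Γ(h, y), y)` is half the
derivative of the metric along `h`. It therefore cancels the base part of the differential of the
energy. -/
lemma vRadial_eq_fderiv_chartEnergy {u' : TangentBundle 𝓘(ℝ, E) M}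
    (hu' : u'.proj ∈ (extChartAt 𝓘(ℝ, E) u.proj).source)
    (w : TangentSpace 𝓘(ℝ, E).tangent u') :
    vRadial g u' w = fderiv ℝ (chartEnergy (chartMetric g u.proj))
      (extChartAt 𝓘(ℝ, E).tangent u u') (tangentCoord₂ u u' w) := by
  have hz := (extChartAt 𝓘(ℝ, E) u.proj).map_source hu'
  have hinv : (chartMetric g u.proj (extChartAt 𝓘(ℝ, E) u.proj u'.proj)).IsInvertible :=
    ContinuousLinearMap.isInvertible_of_pos fun v hv ↦ chartMetric_pos g hz hv
  rw [extChartAt_tangent_apply, fderiv_chartEnergy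
    ((contDiffAt_chartMetric g hz).differentiableAt (by simp)) (chartMetric_symm g _ _),
    tangentCoord₂_eq g hu']
  simp only [map_sub, sub_apply]
  rw [chartChristoffel_spec hinv, lowerChristoffel_apply, chartMetric_tangentCoord g hu']
  change gForm g u'.proj (vComp g u' w) u'.snd = _ + (gForm g u'.proj (vComp g u' w) u'.snd - _)
  ring

lemma hRadial_eq_chartMetric {u' : TangentBundle 𝓘(ℝ, E) M}
    (hu' : u'.proj ∈ (extChartAt 𝓘(ℝ, E) u.proj).source)
    (w : TangentSpace 𝓘(ℝ, E).tangent u') :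
    hRadial g u' w = chartMetric g u.proj (extChartAt 𝓘(ℝ, E).tangent u u').1
      (tangentCoord₂ u u' w).1 (extChartAt 𝓘(ℝ, E).tangent u u').2 := by
  rw [tangentCoord₂_eq g hu', extChartAt_tangent_apply]
  exact (chartMetric_tangentCoord g hu' _ _).symm

variable {X Y : ∀ u : TangentBundle 𝓘(ℝ, E) M, TangentSpace 𝓘(ℝ, E).tangent u}

lemma SmoothFieldAt.vRadial (hX : SmoothFieldAt X u) :
    ContMDiffAt 𝓘(ℝ, E).tangent 𝓘(ℝ, ℝ) ∞ (fun u ↦ vRadial g u (X u)) u :=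
  (hX.vComp g).inner g smoothSectionAt_snd

lemma SmoothFieldAt.hRadial (hX : SmoothFieldAt X u) :
    ContMDiffAt 𝓘(ℝ, E).tangent 𝓘(ℝ, ℝ) ∞ (fun u ↦ hRadial g u (X u)) u :=
  hX.hComp.inner g smoothSectionAt_snd

lemma contMDiff_energy : ContMDiff 𝓘(ℝ, E).tangent 𝓘(ℝ, ℝ) ∞ (energy g) := fun u ↦
  contMDiffAt_const.mul ((smoothSectionAt_snd (u₀ := u)).inner g smoothSectionAt_snd)

/-- The differential of the energy density is the radial part of the vertical component. -/
lemma mvfderiv_energy (w : TangentSpace 𝓘(ℝ, E).tangent u) :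
    mvfderiv 𝓘(ℝ, E).tangent (energy g) u w = vRadial g u w := by
  rw [mvfderiv_eq_fderiv (contMDiff_energy g u),
    vRadial_eq_fderiv_chartEnergy g (mem_extChartAt_source u.proj), tangentCoord₂_self,
    (energy_comp_symm g).fderiv_eq]

lemma contDiffAt_chartEnergy : ContDiffAt ℝ ∞ (chartEnergy (chartMetric g u.proj))
    (extChartAt 𝓘(ℝ, E).tangent u u) := by
  have h : ContDiffAt ℝ ∞ (chartMetric g u.proj) (extChartAt 𝓘(ℝ, E).tangent u u).1 := by
    rw [extChartAt_tangent_self]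
    exact contDiffAt_chartMetric g (mem_extChartAt_target u.proj)
  exact contDiffAt_const.mul (((h.comp _ contDiffAt_fst).clm_apply contDiffAt_snd).clm_apply
    contDiffAt_snd)

lemma mvfderiv_vRadial (hX : SmoothFieldAt X u) (w : TangentSpace 𝓘(ℝ, E).tangent u) :
    mvfderiv 𝓘(ℝ, E).tangent (fun u ↦ vRadial g u (X u)) u w =
      fderiv ℝ (fderiv ℝ (chartEnergy (chartMetric g u.proj))) (extChartAt 𝓘(ℝ, E).tangent u u)
        (tangentCoord₂ u u w) (tangentCoord₂ u u (X u)) +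
      fderiv ℝ (chartEnergy (chartMetric g u.proj)) (extChartAt 𝓘(ℝ, E).tangent u u)
        (fderiv ℝ (fieldInChart u X) (extChartAt 𝓘(ℝ, E).tangent u u) (tangentCoord₂ u u w)) := by
  rw [mvfderiv_eq_fderiv (hX.vRadial g)]
  have h : (fun q ↦ _root_.vRadial g _ (X ((extChartAt 𝓘(ℝ, E).tangent u).symm q))) =ᶠ[
      𝓝 (extChartAt 𝓘(ℝ, E).tangent u u)] fun q ↦
        fderiv ℝ (chartEnergy (chartMetric g u.proj)) q (fieldInChart u X q) :=
    eventually_of_forall_chart fun u' hu' ↦ by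
      beta_reduce
      rw [fieldInChart, extChartAt_tangent_symm_self hu', vRadial_eq_fderiv_chartEnergy g hu']
  have h1 : DifferentiableAt ℝ (fderiv ℝ (chartEnergy (chartMetric g u.proj)))
      (extChartAt 𝓘(ℝ, E).tangent u u) :=
    ((contDiffAt_chartEnergy g).fderiv_right (m := ∞) (by simp)).differentiableAt
      (by simp)
  rw [h.fderiv_eq, fderiv_clm_apply h1 (hX.contDiffAt_fieldInChart.differentiableAt (by simp)),
    fieldInChart_self, tangentCoord₂_self, tangentCoord₂_self, add_comm]
  rfl

/-- The 1-form is exact, hence closed. In the chart this is the symmetry of the second derivative of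
the energy. -/
lemma vRadial_mlieBracket (hX : SmoothFieldAt X u) (hY : SmoothFieldAt Y u) :
    vRadial g u (VectorField.mlieBracket 𝓘(ℝ, E).tangent X Y u) =
      mvfderiv 𝓘(ℝ, E).tangent (fun u ↦ vRadial g u (Y u)) u (X u) -
        mvfderiv 𝓘(ℝ, E).tangent (fun u ↦ vRadial g u (X u)) u (Y u) := by
  rw [mvfderiv_vRadial g hX, mvfderiv_vRadial g hY,
    vRadial_eq_fderiv_chartEnergy g (mem_extChartAt_source u.proj)]
  simp only [tangentCoord₂_self]
  rw [mlieBracket_eq]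
  have hs := (((contDiffAt_chartEnergy (u := u) g).of_le ENat.LEInfty.out :
    ContDiffAt ℝ 2 _ _).isSymmSndFDerivAt (by simp)).eq (X u) (Y u)
  rw [VectorField.lieBracket, fieldInChart_self, fieldInChart_self, map_sub]
  refine Eq.trans ?_ (congrArg₂ (· - ·) (congrArg (· + _) hs) rfl).symm
  abel

lemma mvfderiv_hRadial (hX : SmoothFieldAt X u) (w : TangentSpace 𝓘(ℝ, E).tangent u) :
    mvfderiv 𝓘(ℝ, E).tangent (fun u ↦ hRadial g u (X u)) u w =
      dMetric g u.proj (hComp u w) (hComp u (X u)) u.snd +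
        gFormE g u.proj (fderiv ℝ (fieldInChart u X) (extChartAt 𝓘(ℝ, E).tangent u u) w).1 u.snd +
        gFormE g u.proj (hComp u (X u)) (Prod.snd (α := E) (β := E) w) := by
  rw [mvfderiv_eq_fderiv (hX.hRadial g)]
  have h : (fun q ↦ _root_.hRadial g _ (X ((extChartAt 𝓘(ℝ, E).tangent u).symm q))) =ᶠ[
      𝓝 (extChartAt 𝓘(ℝ, E).tangent u u)] fun q ↦
        chartMetric g u.proj q.1 (fieldInChart u X q).1 q.2 :=
    eventually_of_forall_chart fun u' hu' ↦ by
      beta_reduce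
      rw [fieldInChart, extChartAt_tangent_symm_self hu', hRadial_eq_chartMetric g hu']
  have hG : DifferentiableAt ℝ (chartMetric g u.proj) (extChartAt 𝓘(ℝ, E).tangent u u).1 := by
    rw [extChartAt_tangent_self]
    exact (contDiffAt_chartMetric g (mem_extChartAt_target u.proj)).differentiableAt (by simp)
  have hf : HasFDerivAt (fieldInChart u X) _ (extChartAt 𝓘(ℝ, E).tangent u u) :=
    (hX.contDiffAt_fieldInChart.differentiableAt (by simp)).hasFDerivAt
  have h1 : HasFDerivAt (fun q ↦ (fieldInChart u X q).1) _ (extChartAt 𝓘(ℝ, E).tangent u u) :=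
    hasFDerivAt_fst.comp _ hf
  rw [h.fderiv_eq]
  refine (fderiv_clm_apply₂_fst hG h1.differentiableAt differentiableAt_snd w).trans ?_
  rw [h1.fderiv, fieldInChart_self, fderiv_snd, extChartAt_tangent_self]
  refine congrArg₂ (· + ·) (congrArg₂ (· + ·) rfl ?_) ?_
  · exact chartMetric_self g u.proj _ _
  · exact chartMetric_self g u.proj _ _

/-- The exterior derivative of the 1-form `w ↦ g (τ_* w, u)` on `TM`. -/
lemma hRadial_mlieBracket (hX : SmoothFieldAt X u) (hY : SmoothFieldAt Y u) :
    mvfderiv 𝓘(ℝ, E).tangent (fun u ↦ hRadial g u (Y u)) u (X u) -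
      mvfderiv 𝓘(ℝ, E).tangent (fun u ↦ hRadial g u (X u)) u (Y u) -
      hRadial g u (VectorField.mlieBracket 𝓘(ℝ, E).tangent X Y u) =
    gForm g u.proj (vComp g u (X u)) (hComp u (Y u)) -
      gForm g u.proj (vComp g u (Y u)) (hComp u (X u)) := by
  rw [mvfderiv_hRadial g hX, mvfderiv_hRadial g hY, mlieBracket_eq, VectorField.lieBracket,
    fieldInChart_self, fieldInChart_self]
  generalize fderiv ℝ (fieldInChart u X) (extChartAt 𝓘(ℝ, E).tangent u u) (Y u) = A
  generalize fderiv ℝ (fieldInChart u Y) (extChartAt 𝓘(ℝ, E).tangent u u) (X u) = B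
  generalize X u = x
  generalize Y u = y
  obtain ⟨a, b⟩ := x
  obtain ⟨c, d⟩ := y
  -- The derivatives `A`, `B` of the fields cancel against the bracket. What remains is a pointwise
  -- identity between metric derivatives and Christoffel symbols, settled by expanding the latter.
  have key : ∀ a b c d y : E,
    dMetric g u.proj a c y + gFormE g u.proj B.1 y + gFormE g u.proj c b -
      (dMetric g u.proj c a y + gFormE g u.proj A.1 y + gFormE g u.proj a d) -
      gFormE g u.proj (B - A).1 y =
      gFormE g u.proj (b + christoffel g u.proj a y) c -
        gFormE g u.proj (d + christoffel g u.proj c y) a := by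
    intro a b c d y
    have hs : ∀ v w : E, gFormE g u.proj v w = gFormE g u.proj w v := g.symm u.proj
    simp only [Prod.fst_sub, map_sub, map_add, LinearMap.sub_apply, LinearMap.add_apply,
      gFormE_christoffel]
    rw [hs c b, hs a d, dMetric_symm g u.proj a y c, dMetric_symm g u.proj c y a,
      dMetric_symm g u.proj y c a]
    ring
  exact key a b c d u.snd

end ChartDerivatives

/-! ### Derivatives along a hypersurface -/

section TangentOfHypersurface

variable {F : Type*} [NormedAddCommGroup F] [NormedSpace ℝ F] {H : Type*} [TopologicalSpace H]
  {J : ModelWithCorners ℝ F H} {N : Type*} [TopologicalSpace N] [ChartedSpace H N]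

/-- The difference vanishes on `S`, so tangent vectors annihilate it. This allows the extensions of
`η X` and `η Y` in the exterior derivative to be replaced by explicit ones. -/
lemma mvfderiv_eq_of_eqOn {S U : Set N} {x : N} {p q : N → ℝ} (hU : IsOpen U) (hx : x ∈ U)
    (hp : ContMDiffOn J 𝓘(ℝ, ℝ) ∞ p U) (hq : ContMDiffOn J 𝓘(ℝ, ℝ) ∞ q U)
    (h : ∀ y ∈ S ∩ U, p y = q y) {w : TangentSpace J x} (hw : w ∈ tangentAt J S x) :
    mvfderiv J p x w = mvfderiv J q x w := by
  have h1 := hw U (p - q) hU hx (hp.sub hq) fun y hy ↦ sub_eq_zero.2 (h y hy)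
  have hp' : MDifferentiableAt J 𝓘(ℝ, ℝ) p x :=
    (hp.contMDiffAt (hU.mem_nhds hx)).mdifferentiableAt (by simp)
  have hq' : MDifferentiableAt J 𝓘(ℝ, ℝ) q x :=
    (hq.contMDiffAt (hU.mem_nhds hx)).mdifferentiableAt (by simp)
  rw [mvfderiv_sub hp' hq'] at h1
  exact sub_eq_zero.1 h1

end TangentOfHypersurface

/-! ### `T_r M` as a level set of the energy -/

section SphereBundle

variable {E : Type*} [NormedAddCommGroup E] [NormedSpace ℝ E]

/-- A function vanishing on a level set of a function that is homogeneous of degree two along the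
fibres has zero derivative in the directions tangent to that level set. -/
lemma fderiv_eq_zero_of_level {e f : E × E → ℝ} {q : E × E} {r : ℝ} (hr : 0 < r)
    (he : DifferentiableAt ℝ e q) (hq : e q = r ^ 2 / 2)
    (hhom : ∀ z y (c : ℝ), e (z, c • y) = c ^ 2 * e (z, y)) (hf : DifferentiableAt ℝ f q)
    (h : ∀ᶠ p in 𝓝 q, e p = r ^ 2 / 2 → f p = 0) {w : E × E} (hw : fderiv ℝ e q w = 0) :
    fderiv ℝ f q w = 0 := by
  have hpos : 0 < e q := by rw [hq]; positivity
  have hsq : √(2 * e q) = r := by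
    rw [hq, mul_div_cancel₀ _ (two_ne_zero), Real.sqrt_sq hr.le]
  have hdiff : DifferentiableAt ℝ (fun x : ℝ ↦ r / √(2 * x)) (e q) := by
    refine (differentiableAt_const r).div
      (((differentiableAt_id (𝕜 := ℝ)).const_mul (2 : ℝ)).sqrt (by simp; positivity)) ?_
    change √(2 * e q) ≠ 0
    rw [hsq]
    exact hr.ne'
  have hl : HasFDerivAt (fun p ↦ r / √(2 * e p)) _ q :=
    hdiff.hasDerivAt.comp_hasFDerivAt q he.hasFDerivAt
  -- This is the fibrewise radial retraction onto the level set. It fixes `q`, and its composition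
  -- with `f` vanishes near `q`.
  have hρ : HasFDerivAt (fun p : E × E ↦ (p.1, (r / √(2 * e p)) • p.2)) _ q :=
    hasFDerivAt_fst.prodMk (hl.smul hasFDerivAt_snd)
  have hq' : (q.1, (r / √(2 * e q)) • q.2) = q := by
    simp [hsq, div_self hr.ne']
  have hzero : (fun p : E × E ↦ f (p.1, (r / √(2 * e p)) • p.2)) =ᶠ[𝓝 q] fun _ ↦ 0 := by
    have h1 := hρ.continuousAt.tendsto.eventually (hq'.symm ▸ h)
    filter_upwards [h1, he.continuousAt.eventually (lt_mem_nhds hpos)] with p hp hp0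
    refine hp ?_
    rw [hhom, div_pow, Real.sq_sqrt (by positivity)]
    field_simp
  have hcomp := HasFDerivAt.comp (g := f) (g' := fderiv ℝ f q) q
    (by rw [hq']; exact hf.hasFDerivAt) hρ
  have hd : fderiv ℝ (fun p : E × E ↦ f (p.1, (r / √(2 * e p)) • p.2)) q w = 0 := by
    rw [hzero.fderiv_eq]; simp
  have hd' := hcomp.fderiv
  rw [Function.comp_def] at hd'
  rw [hd'] at hd
  -- The scaling factor depends only on `e`, so its derivative along `w` vanishes. The retraction's
  -- differential then fixes `w`, and the chain rule gives the claim.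
  simpa [hw, hsq, div_self hr.ne'] using hd

variable {M : Type*} [TopologicalSpace M] [ChartedSpace E M] [IsManifold 𝓘(ℝ, E) ∞ M]
  (g : Bundle.ContMDiffRiemannianMetric 𝓘(ℝ, E) ∞ E (fun x : M ↦ TangentSpace 𝓘(ℝ, E) x))
  {r : ℝ} {u : TangentBundle 𝓘(ℝ, E) M}

lemma mem_sphereBundle_iff_energy : u ∈ sphereBundle g r ↔ energy g u = r ^ 2 / 2 := by
  change g.inner u.proj u.snd u.snd = r ^ 2 ↔ (1 / 2 : ℝ) * g.inner u.proj u.snd u.snd = r ^ 2 / 2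
  constructor <;> intro h <;> linarith

lemma gForm_snd_of_mem (hu : u ∈ sphereBundle g r) : gForm g u.proj u.snd u.snd = r ^ 2 := hu

variable [FiniteDimensional ℝ E]

lemma mvfderiv_energy_sub (c : ℝ) (w : TangentSpace 𝓘(ℝ, E).tangent u) :
    mvfderiv 𝓘(ℝ, E).tangent (fun u ↦ energy g u - c) u w = vRadial g u w := by
  rw [mvfderiv_eq_fderiv ((contMDiff_energy g u).sub contMDiffAt_const), fderiv_sub_const,
    ← mvfderiv_eq_fderiv (contMDiff_energy g u), mvfderiv_energy]

/-- The tangent spaces of `T_r M` are the kernels of the 1-form `w ↦ g (K w, u)`. -/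
lemma mem_tangentAt_sphereBundle (hr : 0 < r) (hu : u ∈ sphereBundle g r)
    {w : TangentSpace 𝓘(ℝ, E).tangent u} :
    w ∈ tangentAt 𝓘(ℝ, E).tangent (sphereBundle g r) u ↔ vRadial g u w = 0 := by
  constructor
  · intro h
    rw [← mvfderiv_energy_sub g (r ^ 2 / 2)]
    refine h univ _ isOpen_univ (mem_univ u) ((contMDiff_energy g).sub contMDiff_const).contMDiffOn
      fun y hy ↦ sub_eq_zero.2 ((mem_sphereBundle_iff_energy g).1 hy.1)
  · intro hw U f hU huU hf h0
    have hfu := hf.contMDiffAt (hU.mem_nhds huU)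
    rw [mvfderiv_eq_fderiv hfu]
    have he := (contDiffAt_chartEnergy (u := u) g).differentiableAt (by simp)
    refine fderiv_eq_zero_of_level hr he ?_ ?_
      (hfu.contDiffAt_comp_extChartAt_symm.differentiableAt (by simp)) ?_ ?_
    · rw [← energy_eq_chartEnergy g (mem_extChartAt_source u.proj)]
      exact (mem_sphereBundle_iff_energy g).1 hu
    · intro z y c
      simp [chartEnergy]
      ring
    · have hV : ∀ᶠ q in 𝓝 (extChartAt 𝓘(ℝ, E).tangent u u),
          (extChartAt 𝓘(ℝ, E).tangent u).symm q ∈ U := by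
        refine (continuousAt_extChartAt_symm u).preimage_mem_nhds ?_
        rw [extChartAt_to_inv]
        exact hU.mem_nhds huU
      filter_upwards [hV, energy_comp_symm g] with q hq hq' hqr
      exact h0 _ ⟨(mem_sphereBundle_iff_energy g).2 (hq'.trans hqr), hq⟩
    · rw [vRadial_eq_fderiv_chartEnergy g (mem_extChartAt_source u.proj),
        tangentCoord₂_self] at hw
      exact hw

lemma hLift_add_vLift_ext {v w : TangentSpace 𝓘(ℝ, E).tangent u} (h : hComp u v = hComp u w)
    (h' : vComp g u v = vComp g u w) : v = w := by
  rw [← hLift_add_vLift g u v, ← hLift_add_vLift g u w, h, h']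

/-- `T_r M` is a smooth embedded hypersurface of `TM`. -/
lemma isHypersurface_sphereBundle (hr : 0 < r) :
    IsHypersurface 𝓘(ℝ, E).tangent (sphereBundle g r) := by
  intro u hu
  refine ⟨univ, fun u ↦ energy g u - r ^ 2 / 2, isOpen_univ, mem_univ u,
    ((contMDiff_energy g).sub contMDiff_const).contMDiffOn, ?_, ?_⟩
  · ext y
    simp [mem_sphereBundle_iff_energy, sub_eq_zero]
  · intro h
    have h1 := mvfderiv_energy_sub g (r ^ 2 / 2) (vLift u u.snd)
    rw [h] at h1
    have h2 : vRadial g u (vLift u u.snd) = r ^ 2 := by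
      change gForm g u.proj (vComp g u (vLift u u.snd)) u.snd = r ^ 2
      rw [vComp_vLift]
      exact hu
    rw [h2] at h1
    exact (pow_pos hr 2).ne h1

/-- The radial components of `X` and `Y` vanish on `T_r M`, hence so do their tangential
derivatives. Closedness of the form then makes the bracket tangent. -/
lemma vRadial_mlieBracket_eq_zero (hr : 0 < r) {U : Set (TangentBundle 𝓘(ℝ, E) M)}
    {X Y : ∀ u : TangentBundle 𝓘(ℝ, E) M, TangentSpace 𝓘(ℝ, E).tangent u}
    (hX : IsLocalField 𝓘(ℝ, E).tangent (sphereBundle g r) U X)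
    (hY : IsLocalField 𝓘(ℝ, E).tangent (sphereBundle g r) U Y) (hu : u ∈ sphereBundle g r ∩ U) :
    vRadial g u (VectorField.mlieBracket 𝓘(ℝ, E).tangent X Y u) = 0 := by
  have key : ∀ {X Y : ∀ u : TangentBundle 𝓘(ℝ, E) M, TangentSpace 𝓘(ℝ, E).tangent u},
      IsLocalField 𝓘(ℝ, E).tangent (sphereBundle g r) U X →
      IsLocalField 𝓘(ℝ, E).tangent (sphereBundle g r) U Y →
      mvfderiv 𝓘(ℝ, E).tangent (fun u ↦ vRadial g u (Y u)) u (X u) = 0 := by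
    intro X Y hX hY
    exact hX.tangent u hu U _ hX.isOpen hu.2
      (fun y hy ↦ ((hY.smooth.smoothFieldAt hY.isOpen hy).vRadial g).contMDiffWithinAt)
      fun y hy ↦ (mem_tangentAt_sphereBundle g hr hy.1).1 (hY.tangent y hy)
  rw [vRadial_mlieBracket g (hX.smooth.smoothFieldAt hX.isOpen hu.2)
    (hY.smooth.smoothFieldAt hY.isOpen hu.2), key hX hY, key hY hX, sub_zero]

end SphereBundle

/-! ### The standard form and its contact properties -/

section ContactStructure

variable {E : Type*} [NormedAddCommGroup E] [NormedSpace ℝ E]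
  {M : Type*} [TopologicalSpace M] [ChartedSpace E M] [IsManifold 𝓘(ℝ, E) ∞ M]
  (g : Bundle.ContMDiffRiemannianMetric 𝓘(ℝ, E) ∞ E (fun x : M ↦ TangentSpace 𝓘(ℝ, E) x))
  {u : TangentBundle 𝓘(ℝ, E) M}

lemma gForm_symm (p : M) (v w : TangentSpace 𝓘(ℝ, E) p) : gForm g p v w = gForm g p w v :=
  g.symm p v w

lemma gForm_self_pos (p : M) {v : TangentSpace 𝓘(ℝ, E) p} (hv : v ≠ 0) : 0 < gForm g p v v :=
  g.pos p v hv

lemma gForm_self_nonneg (p : M) (v : TangentSpace 𝓘(ℝ, E) p) : 0 ≤ gForm g p v v := by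
  by_cases h : v = 0
  · simp [h]
  · exact (gForm_self_pos g p h).le

lemma hRadial_apply (w : TangentSpace 𝓘(ℝ, E).tangent u) :
    hRadial g u w = gForm g u.proj (hComp u w) u.snd := rfl

lemma smoothFieldAt_smul_vLift_snd (c : ℝ) :
    SmoothFieldAt (fun u : TangentBundle 𝓘(ℝ, E) M ↦ c • vLift u u.snd) u := by
  simp only [← map_smul]
  exact (SmoothSectionAt.smul contMDiffAt_const smoothSectionAt_snd).vLift

variable [FiniteDimensional ℝ E]

lemma vRadial_apply (w : TangentSpace 𝓘(ℝ, E).tangent u) :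
    vRadial g u w = gForm g u.proj (vComp g u w) u.snd := rfl

/-- The normal form of the almost contact metric structures on `T_r M` considered here. -/
structure IsStandardForm (r s κ : ℝ)
    (φ : ∀ u : TangentBundle 𝓘(ℝ, E) M, TangentSpace 𝓘(ℝ, E).tangent u →ₗ[ℝ]
      TangentSpace 𝓘(ℝ, E).tangent u)
    (ξ : ∀ u : TangentBundle 𝓘(ℝ, E) M, TangentSpace 𝓘(ℝ, E).tangent u)
    (η : ∀ u : TangentBundle 𝓘(ℝ, E) M, TangentSpace 𝓘(ℝ, E).tangent u →ₗ[ℝ] ℝ)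
    (G : ∀ u : TangentBundle 𝓘(ℝ, E) M, TangentSpace 𝓘(ℝ, E).tangent u →ₗ[ℝ]
      TangentSpace 𝓘(ℝ, E).tangent u →ₗ[ℝ] ℝ) : Prop where
  φ_eq : ∀ u ∈ sphereBundle g r, ∀ w, vRadial g u w = 0 → φ u w = hLift g u (-s • vComp g u w) +
    vLift u (s⁻¹ • (hComp u w + (-(hRadial g u w / r ^ 2)) • u.snd))
  ξ_eq : ∀ u ∈ sphereBundle g r, ξ u = hLift g u (κ • u.snd)
  η_eq : ∀ u ∈ sphereBundle g r, ∀ w, vRadial g u w = 0 → η u w = hRadial g u w / (κ * r ^ 2)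
  G_eq : ∀ u ∈ sphereBundle g r, ∀ v w, vRadial g u v = 0 → vRadial g u w = 0 →
    G u v w = 1 / (κ * r) ^ 2 * (gForm g u.proj (hComp u v) (hComp u w) +
      s ^ 2 * gForm g u.proj (vComp g u v) (vComp g u w))

namespace IsStandardForm

variable {g} {r s κ : ℝ}
    {φ : ∀ u : TangentBundle 𝓘(ℝ, E) M, TangentSpace 𝓘(ℝ, E).tangent u →ₗ[ℝ]
      TangentSpace 𝓘(ℝ, E).tangent u}
    {ξ : ∀ u : TangentBundle 𝓘(ℝ, E) M, TangentSpace 𝓘(ℝ, E).tangent u}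
    {η : ∀ u : TangentBundle 𝓘(ℝ, E) M, TangentSpace 𝓘(ℝ, E).tangent u →ₗ[ℝ] ℝ}
    {G : ∀ u : TangentBundle 𝓘(ℝ, E) M, TangentSpace 𝓘(ℝ, E).tangent u →ₗ[ℝ]
      TangentSpace 𝓘(ℝ, E).tangent u →ₗ[ℝ] ℝ}

lemma hComp_φ (h : IsStandardForm g r s κ φ ξ η G) (hu : u ∈ sphereBundle g r)
    {w : TangentSpace 𝓘(ℝ, E).tangent u} (hw : vRadial g u w = 0) :
    hComp u (φ u w) = -s • vComp g u w := by
  rw [h.φ_eq u hu w hw, map_add, hComp_hLift, hComp_vLift, add_zero]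

lemma vComp_φ (h : IsStandardForm g r s κ φ ξ η G) (hu : u ∈ sphereBundle g r)
    {w : TangentSpace 𝓘(ℝ, E).tangent u} (hw : vRadial g u w = 0) :
    vComp g u (φ u w) = s⁻¹ • (hComp u w + (-(hRadial g u w / r ^ 2)) • u.snd) := by
  rw [h.φ_eq u hu w hw, map_add, vComp_hLift, vComp_vLift, zero_add]

lemma hRadial_φ (h : IsStandardForm g r s κ φ ξ η G) (hu : u ∈ sphereBundle g r)
    {w : TangentSpace 𝓘(ℝ, E).tangent u} (hw : vRadial g u w = 0) :
    hRadial g u (φ u w) = 0 := by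
  rw [hRadial_apply, h.hComp_φ hu hw, map_smul, LinearMap.smul_apply, ← vRadial_apply, hw,
    smul_zero]

lemma vRadial_φ (h : IsStandardForm g r s κ φ ξ η G) (hr : 0 < r) (hu : u ∈ sphereBundle g r)
    {w : TangentSpace 𝓘(ℝ, E).tangent u} (hw : vRadial g u w = 0) :
    vRadial g u (φ u w) = 0 := by
  rw [vRadial_apply, h.vComp_φ hu hw]
  simp only [map_smul, map_add, LinearMap.smul_apply, LinearMap.add_apply, ← hRadial_apply,
    gForm_snd_of_mem g hu, smul_eq_mul]
  field_simp
  ring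

lemma vRadial_ξ (h : IsStandardForm g r s κ φ ξ η G) (hu : u ∈ sphereBundle g r) :
    vRadial g u (ξ u) = 0 := by
  rw [h.ξ_eq u hu, vRadial_apply, vComp_hLift, map_zero, LinearMap.zero_apply]

lemma hComp_ξ (h : IsStandardForm g r s κ φ ξ η G) (hu : u ∈ sphereBundle g r) :
    hComp u (ξ u) = κ • u.snd := by
  rw [h.ξ_eq u hu, hComp_hLift]

lemma vComp_ξ (h : IsStandardForm g r s κ φ ξ η G) (hu : u ∈ sphereBundle g r) :
    vComp g u (ξ u) = 0 := by
  rw [h.ξ_eq u hu, vComp_hLift]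

lemma hRadial_ξ (h : IsStandardForm g r s κ φ ξ η G) (hu : u ∈ sphereBundle g r) :
    hRadial g u (ξ u) = κ * r ^ 2 := by
  rw [hRadial_apply, h.hComp_ξ hu, map_smul, LinearMap.smul_apply, gForm_snd_of_mem g hu,
    smul_eq_mul]

theorem isAlmostContactMetric (h : IsStandardForm g r s κ φ ξ η G) (hr : 0 < r) (hs : 0 < s)
    (hκ : κ ≠ 0) : IsAlmostContactMetric 𝓘(ℝ, E).tangent (sphereBundle g r) φ ξ η G := by
  have hT : ∀ {u : TangentBundle 𝓘(ℝ, E) M}, u ∈ sphereBundle g r →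
      ∀ {w : TangentSpace 𝓘(ℝ, E).tangent u},
      w ∈ tangentAt 𝓘(ℝ, E).tangent (sphereBundle g r) u ↔ vRadial g u w = 0 := fun hu ↦
    mem_tangentAt_sphereBundle g hr hu
  constructor
  case φ_tangent => exact fun u hu v hv ↦ (hT hu).2 (h.vRadial_φ hr hu ((hT hu).1 hv))
  case ξ_tangent => exact fun u hu ↦ (hT hu).2 (h.vRadial_ξ hu)
  case φ_smooth =>
    intro U X hX x hx
    -- The formula of the standard form has constant coefficients and makes sense off `T_r M`, so it
    -- is the smooth extension required. The same device serves `ξ`, `η` and `G`.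
    refine ⟨U, fun u ↦ hLift g u (-s • vComp g u (X u)) +
      vLift u (s⁻¹ • (hComp u (X u) + (-(hRadial g u (X u) / r ^ 2)) • u.snd)), hX.isOpen, hx.2,
      smoothField_of_smoothFieldAt fun u hu ↦ ?_,
      fun u hu ↦ h.φ_eq u hu.1 _ ((hT hu.1).1 (hX.tangent u hu))⟩
    have hXu := hX.smooth.smoothFieldAt hX.isOpen hu
    refine SmoothFieldAt.add (SmoothSectionAt.hLift g ?_) (SmoothSectionAt.vLift ?_)
    · exact SmoothSectionAt.smul contMDiffAt_const (hXu.vComp g)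
    · refine SmoothSectionAt.smul contMDiffAt_const (hXu.hComp.add ?_)
      refine SmoothSectionAt.smul ?_ smoothSectionAt_snd
      exact ((hXu.hRadial g).div_const _).neg
  case ξ_smooth =>
    intro x hx
    refine ⟨univ, fun u ↦ hLift g u (κ • u.snd), isOpen_univ, mem_univ x,
      smoothField_of_smoothFieldAt fun u _ ↦ ?_, fun u hu ↦ h.ξ_eq u hu.1⟩
    exact (SmoothSectionAt.smul contMDiffAt_const smoothSectionAt_snd).hLift g
  case η_smooth =>
    intro U X hX x hx
    refine ⟨U, fun u ↦ hRadial g u (X u) / (κ * r ^ 2), hX.isOpen, hx.2, fun u hu ↦ ?_,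
      fun u hu ↦ h.η_eq u hu.1 _ ((hT hu.1).1 (hX.tangent u hu))⟩
    exact (((hX.smooth.smoothFieldAt hX.isOpen hu).hRadial g).div_const _).contMDiffWithinAt
  case G_smooth =>
    intro U X Y hX hY x hx
    refine ⟨U, fun u ↦ 1 / (κ * r) ^ 2 * (gForm g u.proj (hComp u (X u)) (hComp u (Y u)) +
      s ^ 2 * gForm g u.proj (vComp g u (X u)) (vComp g u (Y u))), hX.isOpen, hx.2, fun u hu ↦ ?_,
      fun u hu ↦ h.G_eq u hu.1 _ _ ((hT hu.1).1 (hX.tangent u hu))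
        ((hT hu.1).1 (hY.tangent u hu))⟩
    have hXu := hX.smooth.smoothFieldAt hX.isOpen hu
    have hYu := hY.smooth.smoothFieldAt hX.isOpen hu
    exact (contMDiffAt_const.mul ((hXu.hComp.inner g hYu.hComp).add
      (contMDiffAt_const.mul ((hXu.vComp g).inner g (hYu.vComp g))))).contMDiffWithinAt
  case G_symm =>
    intro u hu v hv w hw
    rw [h.G_eq u hu v w ((hT hu).1 hv) ((hT hu).1 hw), h.G_eq u hu w v ((hT hu).1 hw)
      ((hT hu).1 hv), gForm_symm g _ (hComp u v), gForm_symm g _ (vComp g u v)]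
  case G_pos =>
    intro u hu v hv hv0
    rw [h.G_eq u hu v v ((hT hu).1 hv) ((hT hu).1 hv)]
    refine mul_pos (by positivity) ?_
    have h1 := gForm_self_nonneg g u.proj (hComp u v)
    have h2 := gForm_self_nonneg g u.proj (vComp g u v)
    by_cases h0 : hComp u v = 0
    · have h3 : vComp g u v ≠ 0 := fun h3 ↦ hv0 <| hLift_add_vLift_ext g
        (by rw [h0, map_zero]) (by rw [h3, map_zero])
      have := gForm_self_pos g u.proj h3
      positivity
    · have := gForm_self_pos g u.proj h0
      positivity
  case φ_φ =>
    intro u hu v hv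
    have hv' := (hT hu).1 hv
    have hφv := h.vRadial_φ hr hu hv'
    refine hLift_add_vLift_ext g ?_ ?_
    · rw [h.hComp_φ hu hφv, h.vComp_φ hu hv', h.η_eq u hu v hv']
      simp only [map_add, map_neg, map_smul, h.hComp_ξ hu]
      rw [smul_smul, smul_add, smul_smul, smul_smul]
      match_scalars <;> field_simp
    · rw [h.vComp_φ hu hφv, h.hComp_φ hu hv', h.hRadial_φ hu hv']
      simp only [map_add, map_neg, map_smul, h.vComp_ξ hu, smul_zero, zero_div, neg_zero, zero_smul,
        add_zero]
      match_scalars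
      field_simp
  case φ_ξ =>
    intro u hu
    have hξ := h.vRadial_ξ hu
    refine hLift_add_vLift_ext g ?_ ?_
    · rw [h.hComp_φ hu hξ, h.vComp_ξ hu, smul_zero, map_zero]
    · rw [h.vComp_φ hu hξ, h.hComp_ξ hu, h.hRadial_ξ hu, map_zero]
      match_scalars
      field_simp
      ring
  case η_φ =>
    intro u hu v hv
    have hv' := (hT hu).1 hv
    rw [h.η_eq u hu _ (h.vRadial_φ hr hu hv'), h.hRadial_φ hu hv', zero_div]
  case η_ξ =>
    intro u hu
    rw [h.η_eq u hu _ (h.vRadial_ξ hu), h.hRadial_ξ hu]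
    field_simp
  case compatible =>
    intro u hu v hv w hw
    have hv' := (hT hu).1 hv
    have hw' := (hT hu).1 hw
    rw [h.G_eq u hu _ _ (h.vRadial_φ hr hu hv') (h.vRadial_φ hr hu hw'), h.G_eq u hu v w hv' hw',
      h.η_eq u hu v hv', h.η_eq u hu w hw', h.hComp_φ hu hv', h.hComp_φ hu hw', h.vComp_φ hu hv',
      h.vComp_φ hu hw']
    simp only [map_smul, map_add, LinearMap.smul_apply, LinearMap.add_apply,
      ← hRadial_apply, gForm_snd_of_mem g hu, smul_eq_mul, gForm_symm g u.proj u.snd (hComp u w)]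
    field_simp
    ring

/-- The value `κ = 2 s` is what equates the factors `1 / (2 κ r²)` of `dη` and `s / (κ r)²` of `G
(X, φ Y)`. -/
theorem isContactMetric (h : IsStandardForm g r s (2 * s) φ ξ η G) (hr : 0 < r) (hs : 0 < s) :
    IsContactMetric 𝓘(ℝ, E).tangent (sphereBundle g r) φ ξ η G := by
  refine ⟨h.isAlmostContactMetric hr hs (by positivity), ?_⟩
  intro U X Y p q hX hY hp hq hpX hqY u hu
  have hbr := vRadial_mlieBracket_eq_zero g hr hX hY hu
  refine ⟨(mem_tangentAt_sphereBundle g hr hu.1).2 hbr, ?_⟩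
  have key : ∀ {X Y : ∀ u : TangentBundle 𝓘(ℝ, E) M, TangentSpace 𝓘(ℝ, E).tangent u}
      {p : TangentBundle 𝓘(ℝ, E) M → ℝ},
      IsLocalField 𝓘(ℝ, E).tangent (sphereBundle g r) U X →
      IsLocalField 𝓘(ℝ, E).tangent (sphereBundle g r) U Y →
      ContMDiffOn 𝓘(ℝ, E).tangent 𝓘(ℝ, ℝ) ∞ p U →
      (∀ x ∈ sphereBundle g r ∩ U, p x = η x (X x)) →
      mvfderiv 𝓘(ℝ, E).tangent p u (Y u) =
        mvfderiv 𝓘(ℝ, E).tangent (fun u ↦ hRadial g u (X u)) u (Y u) / (2 * s * r ^ 2) := by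
    intro X Y p hX hY hp hpX
    have hXu : ∀ y ∈ U, ContMDiffAt 𝓘(ℝ, E).tangent 𝓘(ℝ, ℝ) ∞ (fun u ↦ hRadial g u (X u)) y :=
      fun y hy ↦ (hX.smooth.smoothFieldAt hX.isOpen hy).hRadial g
    have hXu' : ∀ y ∈ U, ContMDiffAt 𝓘(ℝ, E).tangent 𝓘(ℝ, ℝ) ∞
        (fun u ↦ (2 * s * r ^ 2)⁻¹ * hRadial g u (X u)) y :=
      fun y hy ↦ contMDiffAt_const.mul (hXu y hy)
    rw [mvfderiv_eq_of_eqOn hX.isOpen hu.2 hp (fun y hy ↦ (hXu' y hy).contMDiffWithinAt) ?_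
      (hY.tangent u hu), mvfderiv_eq_fderiv (hXu' u hu.2), mvfderiv_eq_fderiv (hXu u hu.2),
      fderiv_const_mul ((hXu u hu.2).contDiffAt_comp_extChartAt_symm.differentiableAt (by simp)),
      div_eq_inv_mul]
    · rfl
    · intro y hy
      rw [hpX y hy, h.η_eq y hy.1 _
        ((mem_tangentAt_sphereBundle g hr hy.1).1 (hX.tangent y hy)), div_eq_inv_mul]
  have hX' := (mem_tangentAt_sphereBundle g hr hu.1).1 (hX.tangent u hu)
  have hY' := (mem_tangentAt_sphereBundle g hr hu.1).1 (hY.tangent u hu)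
  have hd := hRadial_mlieBracket g (hX.smooth.smoothFieldAt hX.isOpen hu.2)
    (hY.smooth.smoothFieldAt hY.isOpen hu.2)
  rw [key hX hY hp hpX, key hY hX hq hqY, h.η_eq u hu.1 _ hbr, ← sub_div, ← sub_div, hd]
  beta_reduce
  rw [h.G_eq u hu.1 _ _ hX' (h.vRadial_φ hr hu.1 hY'), h.hComp_φ hu.1 hY', h.vComp_φ hu.1 hY']
  -- The multiple of `u` in the vertical part of `φ Y` drops out, as the vertical component of `X`
  -- is orthogonal to `u`.
  simp only [map_smul, map_add, smul_eq_mul, ← vRadial_apply, hX']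
  rw [gForm_symm g _ (vComp g u (Y u))]
  field_simp
  ring

end IsStandardForm

/-! ### The structure induced by `g_A` and `J_A` -/

section GeneralStructure

variable {a b : ℝ → ℝ} {ε : ℝ}

lemma generalMetric_apply (v w : TangentSpace 𝓘(ℝ, E).tangent u) :
    generalMetric g a b u v w = gForm g u.proj (hComp u v) (hComp u w) +
      a (energy g u) * gForm g u.proj (vComp g u v) (vComp g u w) +
      b (energy g u) * (vRadial g u v * vRadial g u w) := rfl

lemma hComp_generalJ (w : TangentSpace 𝓘(ℝ, E).tangent u) :
    hComp u (generalJ g a b ε u w) = -√(a (energy g u)) • vComp g u w +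
      (1 / (2 * energy g u) * (√(a (energy g u)) +
        ε * √(a (energy g u) + 2 * b (energy g u) * energy g u)) * vRadial g u w) • u.snd := by
  simp only [generalJ, LinearMap.add_apply, LinearMap.sub_apply, LinearMap.smul_apply,
    LinearMap.comp_apply, LinearMap.smulRight_apply, map_add, map_sub, map_smul, hComp_hLift,
    hComp_vLift]
  module

lemma vComp_generalJ (w : TangentSpace 𝓘(ℝ, E).tangent u) :
    vComp g u (generalJ g a b ε u w) = (1 / √(a (energy g u))) • hComp u w +
      (-(1 / (2 * energy g u) * (1 / √(a (energy g u)) +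
        ε * (1 / √(a (energy g u) + 2 * b (energy g u) * energy g u))) * hRadial g u w)) •
          u.snd := by
  simp only [generalJ, LinearMap.add_apply, LinearMap.sub_apply, LinearMap.smul_apply,
    LinearMap.comp_apply, LinearMap.smulRight_apply, map_add, map_sub, map_smul, vComp_hLift,
    vComp_vLift]
  module

variable {r : ℝ}

lemma vRadial_vLift_snd (hu : u ∈ sphereBundle g r) : vRadial g u (vLift u u.snd) = r ^ 2 := by
  rw [vRadial_apply, vComp_vLift, gForm_snd_of_mem g hu]

/-- Pairing with `u^V` is a multiple of the differential of the energy, so `u^V` is normal to `T_r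
M`. -/
lemma generalMetric_vLift_snd (hu : u ∈ sphereBundle g r)
    (w : TangentSpace 𝓘(ℝ, E).tangent u) : generalMetric g a b u w (vLift u u.snd) =
      (a (r ^ 2 / 2) + b (r ^ 2 / 2) * r ^ 2) * vRadial g u w := by
  rw [generalMetric_apply, vRadial_vLift_snd g hu, hComp_vLift, vComp_vLift, ← vRadial_apply,
    (mem_sphereBundle_iff_energy g).1 hu, map_zero]
  ring

theorem isUnitNormal_sphereBundle {ν : ℝ} (hr : 0 < r)
    (hν : ν ^ 2 * (r ^ 2 * (a (r ^ 2 / 2) + b (r ^ 2 / 2) * r ^ 2)) = 1) :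
    IsUnitNormal 𝓘(ℝ, E).tangent (sphereBundle g r) (generalMetric g a b)
      (fun u ↦ ν • vLift u u.snd) where
  smooth x _ := ⟨univ, _, isOpen_univ, mem_univ x,
    smoothField_of_smoothFieldAt fun u _ ↦ smoothFieldAt_smul_vLift_snd ν, fun _ _ ↦ rfl⟩
  unit u hu := by
    rw [map_smul, map_smul, LinearMap.smul_apply, generalMetric_vLift_snd g hu,
      vRadial_vLift_snd g hu, smul_eq_mul, smul_eq_mul]
    linarith
  normal u hu w hw := by
    have hw' := (mem_tangentAt_sphereBundle g hr hu).1 hw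
    have hs : ∀ v w, generalMetric g a b u v w = generalMetric g a b u w v := fun v w ↦ by
      rw [generalMetric_apply, generalMetric_apply, gForm_symm g _ (hComp u v),
        gForm_symm g _ (vComp g u v), mul_comm (_root_.vRadial g u v)]
    rw [hs, map_smul, generalMetric_vLift_snd g hu, hw', mul_zero, smul_zero]

/-- The structure induced on `T_r M` by `g_A` and `J_A`, rescaled by a constant, is of the standard
form. -/
theorem isStandardForm_induced {ν c R : ℝ} (hr : 0 < r) (hε : ε = 1 ∨ ε = -1)
    (ha : 0 < a (r ^ 2 / 2)) (hR : 0 < R)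
    (hRs : R ^ 2 = a (r ^ 2 / 2) + 2 * b (r ^ 2 / 2) * (r ^ 2 / 2)) (hν : ν = 1 / (r * R))
    (hc : c ≠ 0) :
    IsStandardForm g r √(a (r ^ 2 / 2)) (-(c * ε / r))
      (inducedPhi 𝓘(ℝ, E).tangent (generalMetric g a b) (generalJ g a b ε)
        (fun u ↦ ν • vLift u u.snd))
      (fun u ↦ c • inducedXi 𝓘(ℝ, E).tangent (generalJ g a b ε) (fun u ↦ ν • vLift u u.snd) u)
      (fun u ↦ c⁻¹ • inducedEta 𝓘(ℝ, E).tangent (generalMetric g a b) (generalJ g a b ε)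
        (fun u ↦ ν • vLift u u.snd) u)
      (fun u ↦ (c ^ 2)⁻¹ • generalMetric g a b u) := by
  have hs : 0 < √(a (r ^ 2 / 2)) := Real.sqrt_pos.2 ha
  have hss : √(a (r ^ 2 / 2)) ^ 2 = a (r ^ 2 / 2) := Real.sq_sqrt ha.le
  have hRR : √(a (r ^ 2 / 2) + 2 * b (r ^ 2 / 2) * (r ^ 2 / 2)) = R := by
    rw [← hRs, Real.sqrt_sq hR.le]
  have hRs' : a (r ^ 2 / 2) + b (r ^ 2 / 2) * r ^ 2 = R ^ 2 := by rw [hRs]; ring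
  have hεε : ε ^ 2 = 1 := by rcases hε with rfl | rfl <;> norm_num
  have hε0 : ε ≠ 0 := by rcases hε with rfl | rfl <;> norm_num
  -- As `2 t = r² = g (u, u)`, the radial correction in `J_A` cancels the `1 / √a` part and leaves
  -- only the `ε` part.
  have hvJ : ∀ u ∈ sphereBundle g r, ∀ w, vRadial g u (generalJ g a b ε u w) =
      -(ε / R) * hRadial g u w := by
    intro u hu w
    rw [vRadial_apply, vComp_generalJ, (mem_sphereBundle_iff_energy g).1 hu, hRR]
    simp only [map_add, map_smul, LinearMap.add_apply, LinearMap.smul_apply, ← hRadial_apply,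
      gForm_snd_of_mem g hu, smul_eq_mul]
    field_simp
    ring
  constructor
  · intro u hu w hw
    have h1 : inducedPhi 𝓘(ℝ, E).tangent (generalMetric g a b) (generalJ g a b ε)
        (fun u ↦ ν • vLift u u.snd) u w = generalJ g a b ε u w -
          generalMetric g a b u (generalJ g a b ε u w) (ν • vLift u u.snd) •
            (ν • vLift u u.snd) := rfl
    rw [h1, map_smul, generalMetric_vLift_snd g hu, hvJ u hu]
    refine hLift_add_vLift_ext g ?_ ?_
    · simp only [map_sub, map_add, map_smul, hComp_generalJ, hComp_vLift, hComp_hLift, hw,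
        (mem_sphereBundle_iff_energy g).1 hu]
      simp
    · simp only [map_sub, map_add, map_smul, vComp_generalJ, vComp_vLift, vComp_hLift,
        (mem_sphereBundle_iff_energy g).1 hu, hRR, hRs']
      -- Removing the normal part cancels the `ε` part of the radial correction. What is left of the
      -- correction is the projection orthogonal to `u`, scaled by `1 / √a`.
      rw [smul_smul, show (ν • (R ^ 2 * (-(ε / R) * hRadial g u w))) * ν =
        -(ε / (r ^ 2 * R)) * hRadial g u w by rw [hν, smul_eq_mul]; field_simp]
      match_scalars
      · field_simp
      · field_simp
        ring
  · intro u hu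
    change c • -(generalJ g a b ε u (ν • vLift u u.snd)) = _
    refine hLift_add_vLift_ext g ?_ ?_
    · simp only [map_neg, map_smul, hComp_generalJ, hComp_hLift, vComp_vLift,
        vRadial_vLift_snd g hu, (mem_sphereBundle_iff_energy g).1 hu, hRR, hν]
      match_scalars
      field_simp
      ring
    · simp only [map_neg, map_smul, vComp_generalJ, vComp_hLift, hComp_vLift, hRadial_apply]
      simp
  · intro u hu w hw
    change c⁻¹ * generalMetric g a b u (generalJ g a b ε u w) (ν • vLift u u.snd) = _
    rw [map_smul, generalMetric_vLift_snd g hu, hvJ u hu, hRs', hν, smul_eq_mul]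
    field_simp
    rw [hεε, one_mul]
  · intro u hu v w hv hw
    change (c ^ 2)⁻¹ * generalMetric g a b u v w = _
    rw [generalMetric_apply, hv, hw, (mem_sphereBundle_iff_energy g).1 hu, hss]
    have : (-(c * ε / r) * r) ^ 2 = c ^ 2 := by
      field_simp
      rw [hεε]
    rw [this]
    ring

end GeneralStructure

lemma sasakiMetric_eq : sasakiMetric g = generalMetric g (fun _ ↦ 1) (fun _ ↦ 0) := by
  funext u
  simp [sasakiMetric, generalMetric]

/-- With `ε = -1` and both square roots equal to `1`, the radial corrections have coefficient zero,
so the equality holds on the zero section too. -/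
lemma sasakiJ_eq : sasakiJ g = generalJ g (fun _ ↦ 1) (fun _ ↦ 0) (-1) := by
  funext u
  simp [sasakiJ, generalJ]

end ContactStructure

end

theorem proposition3p1 {E : Type*} [NormedAddCommGroup E] [NormedSpace ℝ E]
    [FiniteDimensional ℝ E] {M : Type*} [TopologicalSpace M] [T2Space M]
    [SecondCountableTopology M] [ChartedSpace E M] [IsManifold 𝓘(ℝ, E) ∞ M]
    (g : Bundle.ContMDiffRiemannianMetric 𝓘(ℝ, E) ∞ E (fun x : M ↦ TangentSpace 𝓘(ℝ, E) x)) :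
    (∀ r : ℝ, 0 < r →
      IsHypersurface 𝓘(ℝ, E).tangent (sphereBundle g r) ∧
      IsUnitNormal 𝓘(ℝ, E).tangent (sphereBundle g r) (sasakiMetric g) (sasakiNormal r) ∧
      IsAlmostContactMetric 𝓘(ℝ, E).tangent (sphereBundle g r)
        (phiR g r) (xiR g r) (etaR g r) (sasakiMetric g) ∧
      IsContactMetric 𝓘(ℝ, E).tangent (sphereBundle g r)
        (phiR g r) (fun u ↦ (2 * r) • xiR g r u) (fun u ↦ (1 / (2 * r)) • etaR g r u)
        (fun u ↦ (1 / (4 * r ^ 2)) • sasakiMetric g u)) ∧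
    (∀ (a b : ℝ → ℝ) (ε : ℝ), ContDiffOn ℝ ∞ a (Ici 0) → ContDiffOn ℝ ∞ b (Ici 0) →
      (∀ t, 0 ≤ t → 0 < a t) → (∀ t, 0 ≤ t → 0 < a t + 2 * b t * t) → (ε = 1 ∨ ε = -1) →
      IsHypersurface 𝓘(ℝ, E).tangent (sphereBundle g 1) ∧
      IsUnitNormal 𝓘(ℝ, E).tangent (sphereBundle g 1) (generalMetric g a b) (generalNormal a b) ∧
      IsAlmostContactMetric 𝓘(ℝ, E).tangent (sphereBundle g 1)
        (phiA g a b ε) (xiA g a b ε) (etaA g a b ε) (generalMetric g a b) ∧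
      IsContactMetric 𝓘(ℝ, E).tangent (sphereBundle g 1)
        (phiA g a b ε) (fun u ↦ (-2 * ε * √(a (1 / 2))) • xiA g a b ε u)
        (fun u ↦ (-(ε / (2 * √(a (1 / 2))))) • etaA g a b ε u)
        (fun u ↦ (1 / (4 * a (1 / 2))) • generalMetric g a b u)) := by
  constructor
  · intro r hr
    -- The factor `c = 1` gives the induced structure itself, and `c = 2 r` gives `κ = 2 = 2 s`.
    have hJ : ∀ c : ℝ, c ≠ 0 → IsStandardForm g r 1 (c / r) (phiR g r) (fun u ↦ c • xiR g r u)
        (fun u ↦ c⁻¹ • etaR g r u) (fun u ↦ (c ^ 2)⁻¹ • sasakiMetric g u) := by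
      intro c hc
      have h := isStandardForm_induced g (a := fun _ ↦ 1) (b := fun _ ↦ 0) (ε := -1) (ν := 1 / r)
        (c := c) (R := 1) hr (Or.inr rfl) one_pos one_pos (by norm_num) (by norm_num) hc
      rw [← sasakiMetric_eq, ← sasakiJ_eq, Real.sqrt_one,
        show -(c * -1 / r) = c / r by ring] at h
      exact h
    refine ⟨isHypersurface_sphereBundle g hr, ?_, ?_, ?_⟩
    · rw [sasakiMetric_eq]
      exact isUnitNormal_sphereBundle g hr (by field_simp; ring)
    · have h := (hJ 1 one_ne_zero).isAlmostContactMetric hr one_pos (by positivity)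
      simpa only [one_smul, inv_one, one_pow] using h
    · have h := hJ (2 * r) (by positivity)
      rw [show 2 * r / r = 2 * 1 by field_simp] at h
      have h' := h.isContactMetric hr one_pos
      rwa [show (2 * r) ^ 2 = 4 * r ^ 2 by ring, ← one_div, ← one_div] at h'
  · intro a b ε _ _ ha hab hε
    have ha0 : 0 < a (1 / 2) := ha _ (by norm_num)
    have hR0 : 0 < a (1 / 2) + b (1 / 2) := by
      have := hab (1 / 2) (by norm_num)
      linarith
    have hs : 0 < √(a (1 / 2)) := Real.sqrt_pos.2 ha0
    have hR : 0 < √(a (1 / 2) + b (1 / 2)) := Real.sqrt_pos.2 hR0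
    have hRs : √(a (1 / 2) + b (1 / 2)) ^ 2 = a (1 / 2) + b (1 / 2) := Real.sq_sqrt hR0.le
    have hε0 : ε ≠ 0 := by rcases hε with rfl | rfl <;> norm_num
    have h12 : (1 : ℝ) ^ 2 / 2 = 1 / 2 := by norm_num
    have hJ : ∀ c : ℝ, c ≠ 0 → IsStandardForm g 1 √(a (1 / 2)) (-(c * ε))
        (phiA g a b ε) (fun u ↦ c • xiA g a b ε u)
        (fun u ↦ c⁻¹ • etaA g a b ε u) (fun u ↦ (c ^ 2)⁻¹ • generalMetric g a b u) := by
      intro c hc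
      have h := isStandardForm_induced g (a := a) (b := b) (r := 1)
        (ν := 1 / √(a (1 / 2) + b (1 / 2))) (c := c) (R := √(a (1 / 2) + b (1 / 2))) one_pos hε
        (by rwa [h12]) hR (by rw [h12, hRs]; ring) (by rw [one_mul]) hc
      rw [h12, div_one] at h
      exact h
    refine ⟨isHypersurface_sphereBundle g one_pos, ?_, ?_, ?_⟩
    · refine isUnitNormal_sphereBundle g one_pos ?_
      rw [h12, div_pow, hRs]
      field_simp
    · have h := (hJ 1 one_ne_zero).isAlmostContactMetric one_pos hs (by simpa using hε0)
      simpa only [one_smul, inv_one, one_pow] using h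
    · have h := hJ (-2 * ε * √(a (1 / 2))) (mul_ne_zero (mul_ne_zero (by norm_num) hε0) hs.ne')
      have hεε : ε ^ 2 = 1 := by rcases hε with rfl | rfl <;> norm_num
      rw [show -(-2 * ε * √(a (1 / 2)) * ε) = 2 * √(a (1 / 2)) by
        linear_combination 2 * √(a (1 / 2)) * hεε] at h
      have h' := h.isContactMetric one_pos hs
      rwa [show (-2 * ε * √(a (1 / 2))) ^ 2 = 4 * a (1 / 2) by
          rw [mul_pow, mul_pow, hεε, Real.sq_sqrt ha0.le]; ring, ← one_div (4 * a (1 / 2)),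
        show (-2 * ε * √(a (1 / 2)))⁻¹ = -(ε / (2 * √(a (1 / 2)))) by
          rcases hε with rfl | rfl <;> field_simp] at h'
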